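/- Let $J:\{1,2,\dots\}\to(0,\infty)$ be non-increasing with $\sum_{n\ge1}J(n)<\infty$, and let $0<h<\sum_{n\ge1}J(n)$. For $N\ge1$ let $\Lambda=\{1,\dots,N\}$, $\Omega_\Lambda=\{-1,+1\}^{\Lambda}$, and $$H(\sigma)=-\sum_{\{i,j\}\subseteq\Lambda,\ i\ne j}J(|i-j|)\,\sigma_i\sigma_j-h\sum_{i\in\Lambda}\sigma_i .$$ Let $\mathbf{-1},\mathbf{+1}$ be the constant configurations. For $0\le k\le N$ let $L^{(k)}$ (resp. $R^{(k)}$) be the configuration with spin $+1$ exactly at the $k$ leftmost (resp. rightmost) sites; the two have the same energy. Put $$\Gamma=\max_{0\le k\le N}H(L^{(k)})-H(\mathbf{-1}),\qquad k_c=\min\Big\{k\in\mathbb N:\ \sum_{n\ge k+1}J(n)\le h\Big\},\qquad \mathcal P_c=\{L^{(k_c)},R^{(k_c)}\}.$$ A path is a finite sequence of configurations in which consecutive ones differ at exactly one site; its height $\Phi_\gamma$ is the maximum of $H$ along it. For $\beta\ge0$ let $X$ be the discrete-time Metropolis chain on $\Omega_\Lambda$ with $p(\sigma,\eta)=\frac1N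 e^{-\beta[H(\eta)-H(\sigma)]_+}$ if $\sigma,\eta$ differ at exactly one site, $p(\sigma,\eta)=0$ for all other $\eta\neq\sigma$, and $p(\sigma,\sigma)=1-\sum_{\eta\ne\sigma}p(\sigma,\eta)$. For $A\subseteq\Omega_\Lambda$ let $\tau_A=\inf\{t>0:X(t)\in A\}$, with $\tau_A=\infty$ if there is no such $t$. Then there is $N_0=N_0(J,h)$ such that for every $N\ge N_0$: 1. every path $\gamma$ from $\mathbf{-1}$ to $\mathbf{+1}$ with $\Phi_\gamma-H(\mathbf{-1})=\Gamma$ visits $\mathcal P_c$; 2. for the chain started at $\mathbf{-1}$, $\displaystyle\lim_{\beta\to\infty}\mathbb P_{\mathbf{-1}}\big(\tau_{\mathcal P_c}<\tau_{\{\mathbf{+1}\}}\big)=1$. -/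

import Mathlib

open MeasureTheory ProbabilityTheory Filter Topology
open scoped NNReal ENNReal

noncomputable section

namespace LongRangeIsing

/-- Spin configurations on `Λ = {1, …, N}`; the site `i + 1` of `Λ` is the element `i` of `Fin N`,
and the two spin values `-1, 1` are the elements of `ℤˣ`. -/
abbrev Config (N : ℕ) : Type := Fin N → ℤˣ

/-- The value of a spin as a real number. -/
def spin (s : ℤˣ) : ℝ := ((s : ℤ) : ℝ)

/-- The Hamiltonian with free boundary condition, pair interaction `J` and external field `h`.
The first sum is over unordered pairs of distinct sites, listed as `i < j`. -/
def energy (J : ℕ → ℝ) (h : ℝ) (N : ℕ) (σ : Config N) : ℝ :=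
  -(∑ i : Fin N, ∑ j ∈ Finset.Ioi i, J ((j : ℕ) - (i : ℕ)) * spin (σ i) * spin (σ j))
    - ∑ i : Fin N, h * spin (σ i)

/-- The configuration with all spins equal to `-1`. -/
def minusOne (N : ℕ) : Config N := fun _ => -1

/-- The configuration with all spins equal to `+1`. -/
def plusOne (N : ℕ) : Config N := fun _ => 1

/-- `L^{(k)}`: spin `+1` at the `k` leftmost sites, `-1` elsewhere. -/
def leftConfig (N k : ℕ) : Config N := fun i => if (i : ℕ) + 1 ≤ k then 1 else -1

/-- `R^{(k)}` (for `k ≤ N`): spin `+1` at the `k` rightmost sites, `-1` elsewhere. -/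
def rightConfig (N k : ℕ) : Config N := fun i => if (i : ℕ) + 1 ≤ N - k then -1 else 1

/-- The connectivity matrix: `1 / N` if the configurations differ at exactly one site,
and `0` otherwise. -/
def conn (N : ℕ) (σ η : Config N) : ℝ :=
  if (Finset.univ.filter fun i => σ i ≠ η i).card = 1 then 1 / (N : ℝ) else 0

/-- `γ 0, …, γ n` is a path from `σ` to `η`. -/
def IsPath (N : ℕ) {n : ℕ} (γ : Fin (n + 1) → Config N) (σ η : Config N) : Prop :=
  γ 0 = σ ∧ γ (Fin.last n) = η ∧ ∀ i : Fin n, 0 < conn N (γ i.castSucc) (γ i.succ)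

/-- The height of a path: the maximum of the energy along it. -/
def height (J : ℕ → ℝ) (h : ℝ) (N : ℕ) {n : ℕ} (γ : Fin (n + 1) → Config N) : ℝ :=
  Finset.univ.sup' Finset.univ_nonempty fun i => energy J h N (γ i)

/-- `L^{(k)}` and `R^{(k)}` have the same energy, so that `H(P^{(k)})` makes sense. -/
theorem energy_leftConfig_eq_energy_rightConfig (J : ℕ → ℝ) (h : ℝ) (N k : ℕ) (hk : k ≤ N) :
    energy J h N (leftConfig N k) = energy J h N (rightConfig N k) := by
  have key : ∀ i : Fin N, leftConfig N k i = rightConfig N k (Fin.rev i) := by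
    intro i
    have := i.2
    simp only [leftConfig, rightConfig, Fin.val_rev]
    split_ifs <;> first | rfl | omega
  unfold energy
  have h1 : ∑ i : Fin N, h * spin (leftConfig N k i) =
      ∑ i : Fin N, h * spin (rightConfig N k i) := by
    simp only [key]
    exact Equiv.sum_comp Fin.revPerm (fun i => h * spin (rightConfig N k i))
  have h2 : ∑ i : Fin N, ∑ j ∈ Finset.Ioi i,
        J ((j : ℕ) - (i : ℕ)) * spin (leftConfig N k i) * spin (leftConfig N k j) =
      ∑ i : Fin N, ∑ j ∈ Finset.Ioi i,
        J ((j : ℕ) - (i : ℕ)) * spin (rightConfig N k i) * spin (rightConfig N k j) := by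
    simp only [key]
    rw [Finset.sum_sigma', Finset.sum_sigma']
    refine Finset.sum_bij' (fun x _ => ⟨Fin.rev x.2, Fin.rev x.1⟩)
      (fun x _ => ⟨Fin.rev x.2, Fin.rev x.1⟩) ?_ ?_ ?_ ?_ ?_
    · rintro ⟨i, j⟩ hx
      simpa using hx
    · rintro ⟨i, j⟩ hx
      simpa using hx
    · rintro ⟨i, j⟩ _
      simp
    · rintro ⟨i, j⟩ _
      simp
    · rintro ⟨i, j⟩ hx
      have hi := i.2
      have hj := j.2
      have e : ((Fin.rev i : Fin N) : ℕ) - ((Fin.rev j : Fin N) : ℕ) = (j : ℕ) - (i : ℕ) := by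
        simp only [Fin.val_rev]
        omega
      simp only [e]
      ring
  rw [h1, h2]

/-- `H(P^{(k)})`, the common energy of `L^{(k)}` and `R^{(k)}`. -/
def dropletEnergy (J : ℕ → ℝ) (h : ℝ) (N k : ℕ) : ℝ := energy J h N (leftConfig N k)

/-- `Γ = max_{k = 0, …, N} H(P^{(k)}) - H(-1)`. -/
def Gam (J : ℕ → ℝ) (h : ℝ) (N : ℕ) : ℝ :=
  (Finset.range (N + 1)).sup' Finset.nonempty_range_add_one (dropletEnergy J h N)
    - energy J h N (minusOne N)

/-- The size `k_c` of the critical droplet: the least `k` with `∑_{n ≥ k + 1} J n ≤ h`. -/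
def criticalSize (J : ℕ → ℝ) (h : ℝ) : ℕ := sInf {k : ℕ | ∑' n : ℕ, J (k + 1 + n) ≤ h}

/-- The set of critical configurations `{L^{(k_c)}, R^{(k_c)}}`. -/
def criticalSet (J : ℕ → ℝ) (h : ℝ) (N : ℕ) : Set (Config N) :=
  {leftConfig N (criticalSize J h), rightConfig N (criticalSize J h)}

/-- The Metropolis weight `c(σ, η) exp(-β [H(η) - H(σ)]₊)`; it vanishes for `σ = η`. -/
def weight (J : ℕ → ℝ) (h : ℝ) (N : ℕ) (β : ℝ≥0) (σ η : Config N) : ℝ :=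
  conn N σ η * Real.exp (-(β : ℝ) * max (energy J h N η - energy J h N σ) 0)

/-- The transition matrix of the Metropolis dynamics. Off the diagonal it is given by the
Metropolis weights; the diagonal entry is what remains of the total mass `1`. -/
def transition (J : ℕ → ℝ) (h : ℝ) (N : ℕ) (β : ℝ≥0) (σ η : Config N) : ℝ :=
  if σ = η then 1 - ∑ ζ, weight J h N β σ ζ else weight J h N β σ η

theorem conn_nonneg (N : ℕ) (σ η : Config N) : 0 ≤ conn N σ η := by
  unfold conn
  split_ifs <;> positivity

theorem conn_self (N : ℕ) (σ : Config N) : conn N σ σ = 0 := by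
  simp [conn]

theorem sum_conn_le_one (N : ℕ) (σ : Config N) : ∑ η, conn N σ η ≤ 1 := by
  classical
  have hsub : (Finset.univ.filter fun η : Config N =>
      (Finset.univ.filter fun i => σ i ≠ η i).card = 1) ⊆
      Finset.univ.image fun i : Fin N => Function.update σ i (-σ i) := by
    intro η hη
    obtain ⟨i, hi⟩ := Finset.card_eq_one.mp (Finset.mem_filter.mp hη).2
    refine Finset.mem_image.mpr ⟨i, Finset.mem_univ _, ?_⟩
    funext j
    have hj : σ j ≠ η j ↔ j = i := by
      have := Finset.ext_iff.mp hi j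
      simpa using this
    by_cases hji : j = i
    · subst hji
      have hne := hj.mpr rfl
      rw [Function.update_self]
      rcases Int.units_eq_one_or (σ j) with h1 | h1 <;>
        rcases Int.units_eq_one_or (η j) with h2 | h2 <;> simp_all
    · rw [Function.update_of_ne hji]
      by_contra hne
      exact hji (hj.mp hne)
  have hcard := (Finset.card_le_card hsub).trans Finset.card_image_le
  rw [Finset.card_univ, Fintype.card_fin] at hcard
  unfold conn
  rw [← Finset.sum_filter, Finset.sum_const, nsmul_eq_mul, mul_one_div]
  exact div_le_one_of_le₀ (by exact_mod_cast hcard) (by positivity)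

theorem weight_nonneg (J : ℕ → ℝ) (h : ℝ) (N : ℕ) (β : ℝ≥0) (σ η : Config N) :
    0 ≤ weight J h N β σ η :=
  mul_nonneg (conn_nonneg N σ η) (Real.exp_pos _).le

theorem weight_self (J : ℕ → ℝ) (h : ℝ) (N : ℕ) (β : ℝ≥0) (σ : Config N) :
    weight J h N β σ σ = 0 := by
  simp [weight, conn_self]

theorem sum_weight_le_one (J : ℕ → ℝ) (h : ℝ) (N : ℕ) (β : ℝ≥0) (σ : Config N) :
    ∑ η, weight J h N β σ η ≤ 1 := by
  refine (Finset.sum_le_sum fun η _ => ?_).trans (sum_conn_le_one N σ)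
  refine mul_le_of_le_one_right (conn_nonneg N σ η) (Real.exp_le_one_iff.mpr ?_)
  exact mul_nonpos_of_nonpos_of_nonneg (neg_nonpos.mpr β.coe_nonneg) (le_max_right _ _)

theorem transition_nonneg (J : ℕ → ℝ) (h : ℝ) (N : ℕ) (β : ℝ≥0) (σ η : Config N) :
    0 ≤ transition J h N β σ η := by
  unfold transition
  split_ifs
  · exact sub_nonneg.mpr (sum_weight_le_one J h N β σ)
  · exact weight_nonneg J h N β σ η

theorem sum_transition (J : ℕ → ℝ) (h : ℝ) (N : ℕ) (β : ℝ≥0) (σ : Config N) :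
    ∑ η, transition J h N β σ η = 1 := by
  have e : ∀ η, transition J h N β σ η =
      (if σ = η then 1 - ∑ ζ, weight J h N β σ ζ else 0) + weight J h N β σ η := by
    intro η
    unfold transition
    split_ifs with hη
    · subst hη
      rw [weight_self, add_zero]
    · rw [zero_add]
  simp [e, Finset.sum_add_distrib]

/-- The one-step law of the dynamics from `σ`: mass `transition σ η` at each `η`. -/
def stepLaw (J : ℕ → ℝ) (h : ℝ) (N : ℕ) (β : ℝ≥0) (σ : Config N) : Measure (Config N) :=
  ∑ η, ENNReal.ofReal (transition J h N β σ η) • Measure.dirac η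

instance stepLaw_isProbabilityMeasure (J : ℕ → ℝ) (h : ℝ) (N : ℕ) (β : ℝ≥0) (σ : Config N) :
    IsProbabilityMeasure (stepLaw J h N β σ) := by
  constructor
  simp only [stepLaw, Measure.coe_finsetSum, Finset.sum_apply, Measure.smul_apply,
    measure_univ, smul_eq_mul, mul_one]
  rw [← ENNReal.ofReal_sum_of_nonneg fun η _ => transition_nonneg J h N β σ η, sum_transition,
    ENNReal.ofReal_one]

instance spin_measurableSingletonClass : MeasurableSingletonClass ℤˣ where
  measurableSet_singleton s := ⟨{(s : ℤ)}, measurableSet_singleton _, by ext; simp [Units.ext_iff]⟩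

/-- The transition kernel of the dynamics. -/
def stepKernel (J : ℕ → ℝ) (h : ℝ) (N : ℕ) (β : ℝ≥0) : Kernel (Config N) (Config N) :=
  Kernel.ofFunOfCountable (stepLaw J h N β)

instance stepKernel_isMarkovKernel (J : ℕ → ℝ) (h : ℝ) (N : ℕ) (β : ℝ≥0) :
    IsMarkovKernel (stepKernel J h N β) :=
  ⟨fun σ => stepLaw_isProbabilityMeasure J h N β σ⟩

/-- The transition kernel as a kernel from histories up to time `n`: only the present state,
the one at time `n`, matters. -/
def historyKernel (J : ℕ → ℝ) (h : ℝ) (N : ℕ) (β : ℝ≥0) (n : ℕ) :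
    Kernel ((_ : Finset.Iic n) → Config N) (Config N) :=
  (stepKernel J h N β).comap (fun x => x ⟨n, Finset.mem_Iic.mpr le_rfl⟩) (measurable_pi_apply _)

instance historyKernel_isMarkovKernel (J : ℕ → ℝ) (h : ℝ) (N : ℕ) (β : ℝ≥0) (n : ℕ) :
    IsMarkovKernel (historyKernel J h N β n) := by
  unfold historyKernel
  infer_instance

/-- The law, on the space of trajectories, of the Metropolis chain at inverse temperature `β`
started at `σ`. -/
def chainLaw (J : ℕ → ℝ) (h : ℝ) (N : ℕ) (β : ℝ≥0) (σ : Config N) : Measure (ℕ → Config N) :=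
  Kernel.trajMeasure (X := fun _ => Config N) (Measure.dirac σ) (historyKernel J h N β)

/-- The hitting time `inf {t > 0 : X(t) ∈ A}` of a set along a trajectory; it is `⊤` when the set
is never visited at a positive time. -/
def hittingTime {N : ℕ} (A : Set (Config N)) (X : ℕ → Config N) : ℕ∞ :=
  ⨅ t : ℕ, ⨅ _ : 0 < t ∧ X t ∈ A, (t : ℕ∞)

end LongRangeIsing

end

open LongRangeIsing

/-! Write a configuration as its set `A` of plus sites. Up to the constant energy of `minusOne`, the
energy is twice the interaction cut between `A` and its complement, minus `2h|A|` (`energy_eq_cut`).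
At fixed size `k` only the cut matters, and for large `N` its only minimisers are the two intervals
at the ends (`exists_cut_range_lt`). By pigeonhole `A` misses a long block. If `A` lies on one side
of the block, sliding its sites to the end lowers the cut. If it lies on both sides, the two pieces
barely interact, and joining them gains at least `J 1`.

Along end intervals the energy increment from `k` to `k + 1` is about twice (tail of `J` after `k`)
minus `h`, so the energy rises up to `criticalSize` and does not rise afterwards. Hence `Gam` is the
height of the critical droplet, and every other configuration of that size lies strictly higher
(`Landscape`). A path from `minusOne` to `plusOne` changes the number of plus spins by at most one
per step, so it crosses the critical size. If its height is `Gam`, it can do so only in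
`criticalSet`.

For the dynamics, kill the chain on the critical level. Time reversal bounds the probability of
entering the level at `q` by the Gibbs weight of `q` relative to `minusOne`, times the expected
number of visits to `minusOne` (`mul_sum_entrance_le`). That number is at most the inverse
probability of growing the critical droplet from the left end (`visits_mul_prod_le_one`), of order
`exp (β Gam)`. So each noncritical `q` has entrance probability at most `N ^ criticalSize` times an
exponential in `-β` times a positive energy gap. The same bound on visits shows that the level is
reached almost surely. -/

noncomputable section

namespace LongRangeIsing

/-! ### Interaction sums and the cut -/

/-- The partial sum `J 1 + ⋯ + J m`. -/
def partialSum (J : ℕ → ℝ) (m : ℕ) : ℝ := ∑ n ∈ Finset.range m, J (n + 1)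

/-- The total interaction of the site `a` with the other sites of `{0, …, N - 1}`. -/
def siteSum (J : ℕ → ℝ) (N a : ℕ) : ℝ := partialSum J a + partialSum J (N - 1 - a)

/-- The interaction inside the set `A`. -/
def interior (J : ℕ → ℝ) (A : Finset ℕ) : ℝ := ∑ a ∈ A, ∑ b ∈ A with b < a, J (a - b)

/-- The interaction between the set `A` and its complement in `{0, …, N - 1}`. -/
def cut (J : ℕ → ℝ) (N : ℕ) (A : Finset ℕ) : ℝ := ∑ a ∈ A, siteSum J N a - 2 * interior J A

theorem partialSum_succ (J : ℕ → ℝ) (m : ℕ) :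
    partialSum J (m + 1) = partialSum J m + J (m + 1) :=
  Finset.sum_range_succ _ _

theorem partialSum_mono {J : ℕ → ℝ} (hJ : ∀ n, 1 ≤ n → 0 < J n) : Monotone (partialSum J) :=
  monotone_nat_of_le_succ fun m => by
    rw [partialSum_succ]; linarith [hJ (m + 1) (by omega)]

theorem partialSum_le_tsum {J : ℕ → ℝ} (hJ : ∀ n, 1 ≤ n → 0 < J n)
    (hs : Summable fun n : ℕ => J (n + 1)) (m : ℕ) :
    partialSum J m ≤ ∑' n, J (n + 1) :=
  hs.sum_le_tsum _ fun i _ => (hJ _ (by omega)).le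

theorem tsum_tail_eq {J : ℕ → ℝ} (hs : Summable fun n : ℕ => J (n + 1)) (k : ℕ) :
    ∑' n : ℕ, J (k + 1 + n) = ∑' n, J (n + 1) - partialSum J k := by
  have h := hs.sum_add_tsum_nat_add k
  have e : ∀ n, J (k + 1 + n) = J (n + k + 1) := fun n => by congr 1; omega
  simp only [e, partialSum]
  linarith

/-! ### Rearrangement bounds -/

/-- The `j`-th smallest of a set of positive integers is at least `j`, and `J` is non-increasing. -/
theorem sum_le_partialSum_card {J : ℕ → ℝ} (hJ : ∀ m n, 1 ≤ m → m ≤ n → J n ≤ J m)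
    (D : Finset ℕ) (hD : ∀ d ∈ D, 1 ≤ d) : ∑ d ∈ D, J d ≤ partialSum J D.card := by
  induction D using Finset.induction_on_max with
  | empty => simp [partialSum]
  | insert a s hs ih =>
    have ha : a ∉ s := fun h => (hs a h).false
    have hsub : s ⊆ Finset.Ico 1 a := fun x hx =>
      Finset.mem_Ico.2 ⟨hD x (Finset.mem_insert_of_mem hx), hs x hx⟩
    have hc := Finset.card_le_card hsub
    have ha1 := hD a (Finset.mem_insert_self _ _)
    rw [Nat.card_Ico] at hc
    rw [Finset.sum_insert ha, Finset.card_insert_of_notMem ha, partialSum_succ]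
    have := ih fun d hd => hD d (Finset.mem_insert_of_mem hd)
    have := hJ (s.card + 1) a (by omega) (by omega)
    linarith

/-- The ranks of the elements of `A` run once through `0, …, |A| - 1`. Sliding a set to an end
replaces each site by its rank. -/
theorem sum_card_filter_lt (f : ℕ → ℝ) (A : Finset ℕ) :
    ∑ a ∈ A, f (A.filter (· < a)).card = ∑ i ∈ Finset.range A.card, f i := by
  induction A using Finset.induction_on_max with
  | empty => simp
  | insert a s hs ih =>
    have ha : a ∉ s := fun h => (hs a h).false
    rw [Finset.sum_insert ha, Finset.card_insert_of_notMem ha, Finset.sum_range_succ, ← ih,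
      add_comm]
    congr 1
    · refine Finset.sum_congr rfl fun x hx => ?_
      rw [Finset.filter_insert, if_neg (hs x hx).not_gt]
    · rw [Finset.filter_insert, if_neg (lt_irrefl a), Finset.filter_true_of_mem hs]

theorem sum_card_filter_gt (f : ℕ → ℝ) (A : Finset ℕ) :
    ∑ a ∈ A, f (A.filter (a < ·)).card = ∑ i ∈ Finset.range A.card, f i := by
  induction A using Finset.induction_on_min with
  | empty => simp
  | insert a s hs ih =>
    have ha : a ∉ s := fun h => (hs a h).false
    rw [Finset.sum_insert ha, Finset.card_insert_of_notMem ha, Finset.sum_range_succ, ← ih,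
      add_comm]
    congr 1
    · refine Finset.sum_congr rfl fun x hx => ?_
      rw [Finset.filter_insert, if_neg (hs x hx).not_gt]
    · rw [Finset.filter_insert, if_neg (lt_irrefl a), Finset.filter_true_of_mem hs]

theorem card_filter_lt_le (A : Finset ℕ) (a : ℕ) : (A.filter (· < a)).card ≤ a := by
  have : A.filter (· < a) ⊆ Finset.range a := fun x hx => by
    simpa using (Finset.mem_filter.1 hx).2
  simpa using Finset.card_le_card this

theorem card_filter_gt_le {A : Finset ℕ} {N : ℕ} (hA : A ⊆ Finset.range N) (a : ℕ) :
    (A.filter (a < ·)).card ≤ N - 1 - a := by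
  have : A.filter (a < ·) ⊆ Finset.Ioo a N := fun x hx => by
    have := Finset.mem_filter.1 hx
    exact Finset.mem_Ioo.2 ⟨this.2, by simpa using hA this.1⟩
  have := Finset.card_le_card this
  rw [Nat.card_Ioo] at this
  omega

/-- The interaction inside a set of `k` sites is at most that inside `k` consecutive sites. -/
theorem interior_le {J : ℕ → ℝ} (hJ : ∀ m n, 1 ≤ m → m ≤ n → J n ≤ J m) (A : Finset ℕ) :
    interior J A ≤ ∑ j ∈ Finset.range A.card, partialSum J j := by
  rw [← sum_card_filter_lt]
  refine Finset.sum_le_sum fun a _ => ?_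
  -- The distances from `a` to the smaller sites of `A` are distinct positive integers, as many as
  -- the rank of `a`.
  have hinj : Set.InjOn (fun b => a - b) (A.filter (· < a)) := by
    intro x hx y hy hxy
    have h1 := (Finset.mem_filter.1 hx).2
    have h2 := (Finset.mem_filter.1 hy).2
    simp only at hxy
    omega
  have h := sum_le_partialSum_card hJ ((A.filter (· < a)).image fun b => a - b) (by
    intro d hd
    obtain ⟨b, hb, rfl⟩ := Finset.mem_image.1 hd
    have := (Finset.mem_filter.1 hb).2
    omega)
  rwa [Finset.sum_image hinj, Finset.card_image_of_injOn hinj] at h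

theorem interior_range (J : ℕ → ℝ) (k : ℕ) :
    interior J (Finset.range k) = ∑ j ∈ Finset.range k, partialSum J j := by
  refine Finset.sum_congr rfl fun a ha => ?_
  have : (Finset.range k).filter (· < a) = Finset.range a := by
    ext x; simp at ha ⊢; omega
  rw [this, partialSum, ← Finset.sum_range_reflect]
  refine Finset.sum_congr rfl fun b hb => ?_
  have := Finset.mem_range.1 hb
  congr 1; omega

/-- The site `k` adds its bonds to the `N - 1 - k` sites on its right, while its bonds to the `k`
sites on its left cease to be cut. -/
theorem cut_range_succ (J : ℕ → ℝ) (N k : ℕ) :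
    cut J N (Finset.range (k + 1)) =
      cut J N (Finset.range k) + (partialSum J (N - 1 - k) - partialSum J k) := by
  simp only [cut, interior_range, Finset.sum_range_succ, siteSum]
  ring

/-- Concavity of `partialSum`, since its increments `J` do not increase. -/
theorem partialSum_add_sub_le {J : ℕ → ℝ} (hJ : ∀ m n, 1 ≤ m → m ≤ n → J n ≤ J m)
    {i l : ℕ} (hil : i ≤ l) (m : ℕ) :
    partialSum J (l + m) - partialSum J l ≤ partialSum J (i + m) - partialSum J i := by
  induction m with
  | zero => simp
  | succ m ih =>
    rw [← add_assoc, ← add_assoc, partialSum_succ, partialSum_succ]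
    linarith [hJ (i + m + 1) (l + m + 1) (by omega) (by omega)]

/-- Sites close to the boundary interact the least with the rest of the volume. -/
theorem siteSum_lt {J : ℕ → ℝ} (hJ : ∀ m n, 1 ≤ m → m ≤ n → J n ≤ J m)
    {N M k i x : ℕ} (hik : i < k) (hM : J M < J k) (hM1 : 1 ≤ M) (hix : i < x)
    (hx : x + M ≤ N) (hkM : k ≤ M) :
    siteSum J N i < siteSum J N x := by
  obtain ⟨m, rfl⟩ : ∃ m, x = i + 1 + m := ⟨x - (i + 1), by omega⟩
  obtain ⟨l, rfl⟩ : ∃ l, N = i + 1 + m + l + 1 := ⟨N - (i + 1 + m) - 1, by omega⟩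
  have h := partialSum_add_sub_le hJ (i := i + 1) (l := l + 1) (by omega) m
  have e1 : i + 1 + m + l + 1 - 1 - i = l + 1 + m := by omega
  have e2 : i + 1 + m + l + 1 - 1 - (i + 1 + m) = l := by omega
  unfold siteSum
  rw [e1, e2]
  rw [partialSum_succ, partialSum_succ] at h
  have h1 := hJ (i + 1) k (by omega) (by omega)
  have h2 := hJ M (l + 1) hM1 (by omega)
  linarith

theorem siteSum_reflect (J : ℕ → ℝ) {N a : ℕ} (ha : a < N) :
    siteSum J N (N - 1 - a) = siteSum J N a := by
  unfold siteSum
  rw [Nat.sub_sub_self (by omega), add_comm]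

/-! ### Uniqueness of the minimisers of the cut -/

/-- Moving each site to its rank does not raise any `siteSum`, while the interior of `A` is at most
that of the interval. Unless `A` is the interval, some site is at `|A|` or beyond and moves, which
makes the inequality strict. -/
theorem cut_range_lt_of_left {J : ℕ → ℝ} (hJ : ∀ m n, 1 ≤ m → m ≤ n → J n ≤ J m)
    {N M : ℕ} {A : Finset ℕ} (hM : J M < J A.card) (hM1 : 1 ≤ M) (hkM : A.card ≤ M)
    (hA : ∀ a ∈ A, a + M ≤ N) (hne : A ≠ Finset.range A.card) :
    cut J N (Finset.range A.card) < cut J N A := by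
  have h1 := interior_le hJ A
  have hle : ∀ a ∈ A, siteSum J N (A.filter (· < a)).card ≤ siteSum J N a := fun a ha => by
    rcases (card_filter_lt_le A a).eq_or_lt with h | h
    · rw [h]
    · refine (siteSum_lt hJ ?_ hM hM1 h (hA a ha) hkM).le
      exact Finset.card_lt_card (Finset.filter_ssubset.2 ⟨a, ha, lt_irrefl a⟩)
  obtain ⟨a, ha, hak⟩ : ∃ a ∈ A, A.card ≤ a := by
    by_contra! hc
    exact hne (Finset.eq_of_subset_of_card_le (fun a ha => Finset.mem_range.2 (hc a ha))
      (by simp))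
  have hr : (A.filter (· < a)).card < A.card :=
    Finset.card_lt_card (Finset.filter_ssubset.2 ⟨a, ha, lt_irrefl a⟩)
  have h2 := Finset.sum_lt_sum hle
    ⟨a, ha, siteSum_lt hJ hr hM hM1 (hr.trans_le hak) (hA a ha) hkM⟩
  rw [sum_card_filter_lt] at h2
  unfold cut
  rw [interior_range]
  linarith

/-- The mirror image: ranks are counted from the right, and `siteSum` is invariant under reflection.
-/
theorem cut_range_lt_of_right {J : ℕ → ℝ} (hJ : ∀ m n, 1 ≤ m → m ≤ n → J n ≤ J m)
    {N M : ℕ} {A : Finset ℕ} (hAN : A ⊆ Finset.range N)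
    (hM : J M < J A.card) (hM1 : 1 ≤ M) (hkM : A.card ≤ M)
    (hA : ∀ a ∈ A, M ≤ a + 1) (hne : A ≠ Finset.Ico (N - A.card) N) :
    cut J N (Finset.range A.card) < cut J N A := by
  have h1 := interior_le hJ A
  have hN : ∀ a ∈ A, a < N := fun a ha => Finset.mem_range.1 (hAN ha)
  have hlt : ∀ a ∈ A, (A.filter (a < ·)).card < A.card := fun a ha =>
    Finset.card_lt_card (Finset.filter_ssubset.2 ⟨a, ha, lt_irrefl a⟩)
  have hle : ∀ a ∈ A, siteSum J N (A.filter (a < ·)).card ≤ siteSum J N a := fun a ha => by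
    rw [← siteSum_reflect J (hN a ha)]
    rcases (card_filter_gt_le hAN a).eq_or_lt with h | h
    · rw [h]
    · have := hA a ha
      have := hN a ha
      exact (siteSum_lt hJ (hlt a ha) hM hM1 h (by omega) hkM).le
  have hcard : A.card ≤ N := by simpa using Finset.card_le_card hAN
  obtain ⟨a, ha, hak⟩ : ∃ a ∈ A, a < N - A.card := by
    by_contra! hc
    refine hne (Finset.eq_of_subset_of_card_le
      (fun a ha => Finset.mem_Ico.2 ⟨hc a ha, hN a ha⟩) ?_)
    rw [Nat.card_Ico]; omega
  have h2 : ∑ a ∈ A, siteSum J N (A.filter (a < ·)).card < ∑ a ∈ A, siteSum J N a := by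
    refine Finset.sum_lt_sum hle ⟨a, ha, ?_⟩
    rw [← siteSum_reflect J (hN a ha)]
    have := hA a ha
    have := hlt a ha
    exact siteSum_lt hJ (hlt a ha) hM hM1 (by omega) (by omega) hkM
  rw [sum_card_filter_gt] at h2
  unfold cut
  rw [interior_range]
  linarith

theorem interior_union_le {J : ℕ → ℝ} (hJ : ∀ m n, 1 ≤ m → m ≤ n → J n ≤ J m)
    {M : ℕ} (hM1 : 1 ≤ M) (B C : Finset ℕ) (hBC : ∀ b ∈ B, ∀ c ∈ C, b + M ≤ c) :
    interior J (B ∪ C) ≤ interior J B + interior J C + B.card * C.card * J M := by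
  have hdisj : Disjoint B C := Finset.disjoint_left.2 fun a hb hc => by
    have := hBC a hb a hc; omega
  unfold interior
  rw [Finset.sum_union hdisj]
  have e1 : ∀ b ∈ B, (B ∪ C).filter (· < b) = B.filter (· < b) := fun b hb => by
    rw [Finset.filter_union, Finset.union_eq_left]
    intro c hc
    have := Finset.mem_filter.1 hc
    have := hBC b hb c this.1
    omega
  have e2 : ∀ c ∈ C, ∑ x ∈ B ∪ C with x < c, J (c - x) ≤
      B.card * J M + ∑ x ∈ C with x < c, J (c - x) := fun c hc => by
    rw [Finset.filter_union, Finset.sum_union (Finset.disjoint_filter_filter hdisj)]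
    gcongr
    rw [Finset.filter_true_of_mem fun b hb => by have := hBC b hb c hc; omega]
    rw [← nsmul_eq_mul]
    exact Finset.sum_le_card_nsmul _ _ _ fun b hb =>
      hJ M _ hM1 (by have := hBC b hb c hc; omega)
  have h1 : ∑ a ∈ B, ∑ b ∈ B ∪ C with b < a, J (a - b) = ∑ a ∈ B, ∑ b ∈ B with b < a, J (a - b) :=
    Finset.sum_congr rfl fun b hb => by rw [e1 b hb]
  have h2 := Finset.sum_le_sum e2
  rw [Finset.sum_add_distrib, Finset.sum_const, nsmul_eq_mul] at h2
  rw [h1]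
  linarith

/-- Two intervals placed side by side gain at least the bond of length one between them. -/
theorem sum_partialSum_add_lt {J : ℕ → ℝ} (hJpos : ∀ n, 1 ≤ n → 0 < J n) {p q : ℕ}
    (hp : 1 ≤ p) (hq : 1 ≤ q) :
    ∑ j ∈ Finset.range p, partialSum J j + ∑ j ∈ Finset.range q, partialSum J j + J 1 ≤
      ∑ j ∈ Finset.range (p + q), partialSum J j := by
  obtain ⟨q, rfl⟩ : ∃ r, q = r + 1 := ⟨q - 1, by omega⟩
  rw [Finset.sum_range_add _ p, add_assoc, add_le_add_iff_left]
  rw [Finset.sum_range_succ', Finset.sum_range_succ']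
  have h1 : ∑ x ∈ Finset.range q, partialSum J (x + 1) ≤
      ∑ x ∈ Finset.range q, partialSum J (p + (x + 1)) :=
    Finset.sum_le_sum fun x _ => partialSum_mono hJpos (by omega)
  have h2 : partialSum J 1 ≤ partialSum J (p + 0) := partialSum_mono hJpos (by omega)
  have h3 : partialSum J 0 = 0 := by simp [partialSum]
  have h4 : partialSum J 1 = J 1 := by simp [partialSum]
  linarith

/-- Every site of `B` or `C` has at least `M - 1` sites on the side facing the gap, so its total
interaction in that direction is within a tail of the full sum. The pieces interact by at most
`|B||C| J M`. In `hsmall` these errors are below the gain `J 1` from joining the pieces. -/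
theorem cut_range_lt_of_gap {J : ℕ → ℝ} (hJpos : ∀ n, 1 ≤ n → 0 < J n)
    (hJ : ∀ m n, 1 ≤ m → m ≤ n → J n ≤ J m) (hs : Summable fun n : ℕ => J (n + 1))
    {N M : ℕ} (hM1 : 1 ≤ M) {B C : Finset ℕ} (hB : B.Nonempty) (hC : C.Nonempty)
    (hBC : ∀ b ∈ B, ∀ c ∈ C, b + M ≤ c) (hCN : C ⊆ Finset.range N)
    (hsmall : (B.card + C.card) * (∑' n, J (n + 1) - partialSum J (M - 1)) +
      2 * (B.card * C.card * J M) < J 1) :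
    cut J N (Finset.range (B.card + C.card)) < cut J N (B ∪ C) := by
  have hdisj : Disjoint B C := Finset.disjoint_left.2 fun a hb hc => by
    have := hBC a hb a hc; omega
  have hN : ∀ a ∈ C, a < N := fun a ha => Finset.mem_range.1 (hCN ha)
  have h1 := interior_union_le hJ hM1 B C hBC
  have h2 := interior_le hJ B
  have h3 := interior_le hJ C
  have h4 := sum_partialSum_add_lt hJpos hB.card_pos hC.card_pos
  obtain ⟨b₀, hb₀⟩ := hB
  obtain ⟨c₀, hc₀⟩ := hC
  have h5 : ∑ b ∈ B, (partialSum J (B.filter (· < b)).card + partialSum J (M - 1)) ≤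
      ∑ b ∈ B, siteSum J N b := Finset.sum_le_sum fun b hb => by
    have := hBC b hb c₀ hc₀
    have := hN c₀ hc₀
    exact add_le_add (partialSum_mono hJpos (card_filter_lt_le B b))
      (partialSum_mono hJpos (by omega))
  have h6 : ∑ c ∈ C, (partialSum J (M - 1) + partialSum J (C.filter (c < ·)).card) ≤
      ∑ c ∈ C, siteSum J N c := Finset.sum_le_sum fun c hc => by
    have := hBC b₀ hb₀ c hc
    exact add_le_add (partialSum_mono hJpos (by omega))
      (partialSum_mono hJpos (card_filter_gt_le hCN c))
  rw [Finset.sum_add_distrib, sum_card_filter_lt, Finset.sum_const, nsmul_eq_mul] at h5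
  rw [Finset.sum_add_distrib, sum_card_filter_gt, Finset.sum_const, nsmul_eq_mul] at h6
  have h7 : ∑ i ∈ Finset.range (B.card + C.card), siteSum J N i ≤
      ∑ i ∈ Finset.range (B.card + C.card), partialSum J i +
        (B.card + C.card) * ∑' n, J (n + 1) := by
    unfold siteSum
    rw [Finset.sum_add_distrib]
    gcongr
    refine (Finset.sum_le_card_nsmul _ _ _ fun i _ => partialSum_le_tsum hJpos hs _).trans ?_
    simp
  unfold cut
  rw [interior_range, Finset.sum_union hdisj]
  linarith

/-- Pigeonhole: `|A|` sites cannot meet all of `|A| + 1` disjoint blocks of length `M`. -/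
theorem exists_block_disjoint (A : Finset ℕ) (M : ℕ) :
    ∃ r ≤ A.card, ∀ a ∈ A, a < r * M ∨ (r + 1) * M ≤ a := by
  by_contra! hc
  have : Finset.range (A.card + 1) ⊆ A.image (· / M) := fun r hr => by
    obtain ⟨a, ha, h1, h2⟩ := hc r (by simpa [Nat.lt_succ_iff] using hr)
    refine Finset.mem_image.2 ⟨a, ha, ?_⟩
    exact Nat.div_eq_of_lt_le h1 h2
  have := (Finset.card_le_card this).trans Finset.card_image_le
  simp at this

/-- In a large volume the two extremal intervals are the only minimisers of the cut
among the sets of `k` sites. -/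
theorem exists_cut_range_lt {J : ℕ → ℝ} (hJpos : ∀ n, 1 ≤ n → 0 < J n)
    (hJ : ∀ m n, 1 ≤ m → m ≤ n → J n ≤ J m) (hs : Summable fun n : ℕ => J (n + 1))
    {k : ℕ} (hk : 1 ≤ k) :
    ∃ N₀ : ℕ, ∀ N, N₀ ≤ N → ∀ A : Finset ℕ, A ⊆ Finset.range N → A.card = k →
      A ≠ Finset.range k → A ≠ Finset.Ico (N - k) N →
      cut J N (Finset.range k) < cut J N A := by
  have hJ0 : Tendsto (fun n => J (n + 1)) atTop (𝓝 0) := hs.tendsto_atTop_zero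
  have hT : Tendsto (partialSum J) atTop (𝓝 (∑' n, J (n + 1))) := hs.hasSum.tendsto_sum_nat
  have hlim : Tendsto (fun m => k * (∑' n, J (n + 1) - partialSum J m) +
      2 * (k * k * J (m + 1))) atTop (𝓝 0) := by
    simpa using ((hT.const_sub (∑' n, J (n + 1))).const_mul (k : ℝ)).add
      ((hJ0.const_mul ((k : ℝ) * k)).const_mul 2)
  -- The block length is `m + 1`. The first condition serves the one-sided cases, the second the
  -- case of two pieces; `k + 1` blocks must fit into the volume.
  obtain ⟨m, ⟨hm1, hm2⟩, hm3⟩ := (((hJ0.eventually_lt_const (hJpos k hk)).and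
    (hlim.eventually_lt_const (hJpos 1 le_rfl))).and (eventually_ge_atTop k)).exists
  refine ⟨(k + 1) * (m + 1), fun N hN A hAN hAk h1 h2 => ?_⟩
  subst hAk
  obtain ⟨r, hr, hA⟩ := exists_block_disjoint A (m + 1)
  have hrN : (r + 1) * (m + 1) ≤ N :=
    (Nat.mul_le_mul_right _ (by omega)).trans hN
  have hsplit : A.filter (· < r * (m + 1)) ∪ A.filter ((r + 1) * (m + 1) ≤ ·) = A := by
    rw [← Finset.filter_or]
    exact Finset.filter_true_of_mem hA
  rw [add_mul, one_mul] at hrN hsplit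
  set B := A.filter (· < r * (m + 1)) with hB
  set C := A.filter (r * (m + 1) + (m + 1) ≤ ·) with hC
  have hBC : ∀ b ∈ B, ∀ c ∈ C, b + (m + 1) ≤ c := fun b hb c hc => by
    have := (Finset.mem_filter.1 hb).2
    have := (Finset.mem_filter.1 hc).2
    omega
  rcases C.eq_empty_or_nonempty with hC0 | hC0
  · refine cut_range_lt_of_left hJ hm1 (by omega) (by omega) (fun a ha => ?_) h1
    rw [hC0, Finset.union_empty] at hsplit
    rw [← hsplit] at ha
    have := (Finset.mem_filter.1 ha).2
    omega
  rcases B.eq_empty_or_nonempty with hB0 | hB0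
  · refine cut_range_lt_of_right hJ hAN hm1 (by omega) (by omega) (fun a ha => ?_) h2
    rw [hB0, Finset.empty_union] at hsplit
    rw [← hsplit] at ha
    have := (Finset.mem_filter.1 ha).2
    omega
  have hdisj : Disjoint B C := Finset.disjoint_left.2 fun a hb hc => by
    have := hBC a hb a hc; omega
  have hcard := Finset.card_union_of_disjoint hdisj
  rw [hsplit] at hcard
  have hgap := cut_range_lt_of_gap hJpos hJ hs (N := N) (M := m + 1) (by omega) hB0 hC0 hBC
    ((Finset.filter_subset _ _).trans hAN) ?_
  · rwa [hsplit, ← hcard] at hgap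
  · have hc : (A.card : ℝ) = B.card + C.card := by exact_mod_cast hcard
    have hb : (B.card : ℝ) ≤ A.card := by exact_mod_cast Finset.card_filter_le _ _
    have hc' : (C.card : ℝ) ≤ A.card := by exact_mod_cast Finset.card_filter_le _ _
    rw [← hc, Nat.add_sub_cancel]
    refine lt_of_le_of_lt ?_ hm2
    have := (hJpos (m + 1) (by omega)).le
    gcongr

/-! ### Configurations as sets of plus sites -/

/-- The set of sites with spin `+1`. -/
def plusSites {N : ℕ} (σ : Config N) : Finset ℕ :=
  (Finset.univ.filter fun i => σ i = 1).map Fin.valEmbedding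

theorem plusSites_subset {N : ℕ} (σ : Config N) : plusSites σ ⊆ Finset.range N := by
  intro a ha
  obtain ⟨i, -, rfl⟩ := Finset.mem_map.1 ha
  exact Finset.mem_range.2 i.2

theorem val_mem_plusSites {N : ℕ} {σ : Config N} {i : Fin N} :
    (i : ℕ) ∈ plusSites σ ↔ σ i = 1 := by
  simp [plusSites, Fin.val_inj]

theorem plusSites_injective (N : ℕ) : Function.Injective (plusSites (N := N)) := by
  intro σ η h
  funext i
  have : σ i = 1 ↔ η i = 1 := by rw [← val_mem_plusSites, h, val_mem_plusSites]
  rcases Int.units_eq_one_or (σ i) with h1 | h1 <;>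
    rcases Int.units_eq_one_or (η i) with h2 | h2 <;> simp_all

theorem plusSites_minusOne (N : ℕ) : plusSites (minusOne N) = ∅ := by
  simp [plusSites, minusOne, Finset.filter_false_of_mem]

theorem mem_plusSites {N : ℕ} {σ : Config N} {a : ℕ} :
    a ∈ plusSites σ ↔ ∃ ha : a < N, σ ⟨a, ha⟩ = 1 := by
  constructor
  · intro h
    have ha := Finset.mem_range.1 (plusSites_subset σ h)
    exact ⟨ha, (val_mem_plusSites (i := ⟨a, ha⟩)).1 h⟩
  · rintro ⟨ha, h⟩
    exact (val_mem_plusSites (i := ⟨a, ha⟩)).2 h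

theorem plusSites_leftConfig {N k : ℕ} (hk : k ≤ N) :
    plusSites (leftConfig N k) = Finset.range k := by
  ext a
  rw [mem_plusSites, Finset.mem_range]
  simp only [leftConfig]
  constructor
  · rintro ⟨_, h⟩
    by_contra hc
    rw [if_neg (by omega)] at h
    exact absurd h (by decide)
  · intro ha
    exact ⟨by omega, if_pos (by omega)⟩

theorem plusSites_rightConfig (N k : ℕ) :
    plusSites (rightConfig N k) = Finset.Ico (N - k) N := by
  ext a
  rw [mem_plusSites, Finset.mem_Ico]
  simp only [rightConfig]
  constructor
  · rintro ⟨ha, h⟩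
    refine ⟨?_, ha⟩
    by_contra hc
    rw [if_pos (by omega)] at h
    exact absurd h (by decide)
  · rintro ⟨h, ha⟩
    exact ⟨ha, if_neg (by omega)⟩

theorem leftConfig_zero (N : ℕ) : leftConfig N 0 = minusOne N :=
  plusSites_injective N (by rw [plusSites_leftConfig (Nat.zero_le N), plusSites_minusOne]; rfl)

theorem plusOne_eq_leftConfig (N : ℕ) : plusOne N = leftConfig N N := by
  funext i
  simp [plusOne, leftConfig]

theorem sum_plusSites {N : ℕ} (σ : Config N) (f : ℕ → ℝ) :
    ∑ a ∈ plusSites σ, f a = ∑ i : Fin N, if σ i = 1 then f i else 0 := by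
  rw [plusSites, Finset.sum_map, Finset.sum_filter]
  rfl

theorem sum_Ioi_interaction (J : ℕ → ℝ) {N : ℕ} (i : Fin N) :
    ∑ j ∈ Finset.Ioi i, J ((j : ℕ) - i) = partialSum J (N - 1 - i) := by
  have h : ∑ j ∈ Finset.Ioi i, J ((j : ℕ) - i) = ∑ b ∈ Finset.Ioo (i : ℕ) N, J (b - i) := by
    rw [← Fin.map_valEmbedding_Ioi, Finset.sum_map]; rfl
  rw [h, partialSum]
  refine Finset.sum_bij' (fun b _ => b - i - 1) (fun n _ => n + 1 + i) ?_ ?_ ?_ ?_ ?_ <;>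
    intro b hb <;> simp only [Finset.mem_Ioo, Finset.mem_range] at hb ⊢
  · omega
  · omega
  · omega
  · omega
  · congr 1; omega

theorem sum_Iio_interaction (J : ℕ → ℝ) {N : ℕ} (j : Fin N) :
    ∑ i ∈ Finset.Iio j, J ((j : ℕ) - i) = partialSum J j := by
  have h : ∑ i ∈ Finset.Iio j, J ((j : ℕ) - i) = ∑ b ∈ Finset.range (j : ℕ), J (j - b) := by
    rw [← Nat.Iio_eq_range, ← Fin.map_valEmbedding_Iio, Finset.sum_map]; rfl
  rw [h, partialSum, ← Finset.sum_range_reflect]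
  refine Finset.sum_congr rfl fun b hb => ?_
  have := Finset.mem_range.1 hb
  congr 1; omega

theorem sum_Ioi_comm {N : ℕ} (f : Fin N → Fin N → ℝ) :
    ∑ i, ∑ j ∈ Finset.Ioi i, f i j = ∑ j, ∑ i ∈ Finset.Iio j, f i j :=
  Finset.sum_comm' (by simp)

theorem interior_plusSites (J : ℕ → ℝ) {N : ℕ} (σ : Config N) :
    interior J (plusSites σ) = ∑ i : Fin N, ∑ j ∈ Finset.Ioi i,
      J ((j : ℕ) - i) * (if σ i = 1 then 1 else 0) * (if σ j = 1 then 1 else 0) := by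
  rw [sum_Ioi_comm, interior, sum_plusSites]
  refine Finset.sum_congr rfl fun j _ => ?_
  split_ifs with hj
  · rw [Finset.sum_filter, sum_plusSites]
    rw [← Finset.sum_subset (Finset.subset_univ (Finset.Iio j))]
    · refine Finset.sum_congr rfl fun i hi => ?_
      have : (i : ℕ) < j := Fin.lt_def.1 (Finset.mem_Iio.1 hi)
      simp [this]
    · intro i _ hi
      have : ¬ (i : ℕ) < j := fun h => hi (Finset.mem_Iio.2 h)
      simp [this]
  · simp

/-- With `x` the indicator of the plus sites, each spin is `2x - 1`. In the expanded product the
quadratic part gives `interior`, the two linear parts together give `siteSum`, and the constant part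
is the energy of `minusOne`. -/
theorem energy_eq_cut (J : ℕ → ℝ) (h : ℝ) {N : ℕ} (σ : Config N) :
    energy J h N σ = energy J h N (minusOne N) + 2 * cut J N (plusSites σ)
      - 2 * h * (plusSites σ).card := by
  set x : Fin N → ℝ := fun i => if σ i = 1 then 1 else 0 with hx
  have hs : ∀ i, spin (σ i) = 2 * x i - 1 := fun i => by
    rcases Int.units_eq_one_or (σ i) with h1 | h1
    · simp [spin, hx, h1]; norm_num
    · have : (-1 : ℤˣ) ≠ 1 := by decide
      simp [spin, hx, h1, this]
  have hm : ∀ i, spin (minusOne N i) = -1 := fun i => by simp [spin, minusOne]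
  have hc : ((plusSites σ).card : ℝ) = ∑ i, x i := by
    simp [plusSites, hx]
  have h1 : ∑ i : Fin N, ∑ j ∈ Finset.Ioi i, J ((j : ℕ) - i) * x i =
      ∑ i, x i * partialSum J (N - 1 - i) :=
    Finset.sum_congr rfl fun i _ => by
      rw [← sum_Ioi_interaction, Finset.mul_sum]; exact Finset.sum_congr rfl fun _ _ => mul_comm _ _
  have h2 : ∑ i : Fin N, ∑ j ∈ Finset.Ioi i, J ((j : ℕ) - i) * x j =
      ∑ i, x i * partialSum J i := by
    rw [sum_Ioi_comm]
    refine Finset.sum_congr rfl fun i _ => ?_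
    rw [← sum_Iio_interaction, Finset.mul_sum]; exact Finset.sum_congr rfl fun _ _ => mul_comm _ _
  have h3 : ∑ a ∈ plusSites σ, siteSum J N a =
      ∑ i, x i * partialSum J i + ∑ i, x i * partialSum J (N - 1 - i) := by
    rw [sum_plusSites, ← Finset.sum_add_distrib]
    refine Finset.sum_congr rfl fun i _ => ?_
    simp only [hx, siteSum]
    split_ifs <;> ring
  have h4 : interior J (plusSites σ) =
      ∑ i : Fin N, ∑ j ∈ Finset.Ioi i, J ((j : ℕ) - i) * x i * x j := interior_plusSites J σ
  have h5 : ∑ i, h * (2 * x i - 1) = 2 * h * ∑ i, x i + ∑ _i : Fin N, h * -1 := by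
    rw [Finset.mul_sum, ← Finset.sum_add_distrib]
    exact Finset.sum_congr rfl fun _ _ => by ring
  rw [cut, h3, h4, hc, ← h1, ← h2]
  simp only [energy, hs, hm]
  have e : ∀ i j : Fin N, J ((j : ℕ) - i) * (2 * x i - 1) * (2 * x j - 1) =
      4 * (J ((j : ℕ) - i) * x i * x j) - 2 * (J ((j : ℕ) - i) * x i)
        - 2 * (J ((j : ℕ) - i) * x j) + J ((j : ℕ) - i) * -1 * -1 := fun i j => by ring
  rw [h5]
  simp only [e, Finset.sum_add_distrib, Finset.sum_sub_distrib, ← Finset.mul_sum]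
  ring

/-! ### Energy profile of the droplets -/

theorem dropletEnergy_succ (J : ℕ → ℝ) (h : ℝ) {N k : ℕ} (hk : k + 1 ≤ N) :
    dropletEnergy J h N (k + 1) = dropletEnergy J h N k +
      2 * (partialSum J (N - 1 - k) - partialSum J k - h) := by
  unfold dropletEnergy
  rw [energy_eq_cut, energy_eq_cut J h (leftConfig N k), plusSites_leftConfig hk,
    plusSites_leftConfig (by omega), cut_range_succ, Finset.card_range, Finset.card_range]
  push_cast
  ring

theorem dropletEnergy_zero (J : ℕ → ℝ) (h : ℝ) (N : ℕ) :
    dropletEnergy J h N 0 = energy J h N (minusOne N) := by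
  rw [dropletEnergy, leftConfig_zero]

theorem criticalSize_eq {J : ℕ → ℝ} {h : ℝ} (hs : Summable fun n : ℕ => J (n + 1)) :
    criticalSize J h = sInf {k : ℕ | ∑' n, J (n + 1) - partialSum J k ≤ h} := by
  simp only [criticalSize, tsum_tail_eq hs]

theorem tsum_sub_criticalSize_le {J : ℕ → ℝ} {h : ℝ} (hs : Summable fun n : ℕ => J (n + 1))
    (hh : 0 < h) : ∑' n, J (n + 1) - partialSum J (criticalSize J h) ≤ h := by
  rw [criticalSize_eq hs]
  -- The infimum of an empty set of naturals would be `0`; the set is nonempty because the tails of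
  -- `J` tend to `0 < h`.
  refine Nat.sInf_mem (s := {k : ℕ | ∑' n, J (n + 1) - partialSum J k ≤ h}) ?_
  have hT : Tendsto (partialSum J) atTop (𝓝 (∑' n, J (n + 1))) := hs.hasSum.tendsto_sum_nat
  obtain ⟨k, hk⟩ := (hT.eventually_const_lt (sub_lt_self _ hh)).exists
  exact ⟨k, show _ ≤ h by linarith⟩

theorem lt_tsum_sub_of_lt_criticalSize {J : ℕ → ℝ} {h : ℝ}
    (hs : Summable fun n : ℕ => J (n + 1)) {k : ℕ} (hk : k < criticalSize J h) :
    h < ∑' n, J (n + 1) - partialSum J k := by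
  rw [criticalSize_eq hs] at hk
  exact not_le.1 (Nat.notMem_of_lt_sInf hk)

theorem one_le_criticalSize {J : ℕ → ℝ} {h : ℝ} (hs : Summable fun n : ℕ => J (n + 1))
    (hh : 0 < h) (hlt : h < ∑' n, J (n + 1)) : 1 ≤ criticalSize J h := by
  by_contra! hc
  have := tsum_sub_criticalSize_le hs hh
  rw [Nat.lt_one_iff.1 hc] at this
  simp [partialSum] at this
  linarith

/-- In a large volume the energy of the droplets increases up to the critical size and
decreases from there on. -/
theorem exists_dropletEnergy_unimodal {J : ℕ → ℝ} {h : ℝ} (hJpos : ∀ n, 1 ≤ n → 0 < J n)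
    (hs : Summable fun n : ℕ => J (n + 1)) (hh : 0 < h) (hlt : h < ∑' n, J (n + 1)) :
    ∃ N₀ : ℕ, ∀ N, N₀ ≤ N →
      (∀ k, k < criticalSize J h → dropletEnergy J h N k ≤ dropletEnergy J h N (k + 1)) ∧
      (∀ k, criticalSize J h ≤ k → k + 1 ≤ N →
        dropletEnergy J h N (k + 1) ≤ dropletEnergy J h N k) := by
  have hc := one_le_criticalSize hs hh hlt
  have h1 := lt_tsum_sub_of_lt_criticalSize hs (Nat.sub_lt hc one_pos)
  have hT : Tendsto (partialSum J) atTop (𝓝 (∑' n, J (n + 1))) := hs.hasSum.tendsto_sum_nat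
  -- With `m` sites to the right of the growing droplet, the increment is already positive at size
  -- `criticalSize - 1`, hence at all smaller sizes.
  obtain ⟨m, hm⟩ := (hT.eventually_const_lt (lt_sub_iff_add_lt.1 h1)).exists
  refine ⟨criticalSize J h + m, fun N hN => ⟨fun k hk => ?_, fun k hk hkN => ?_⟩⟩
  · rw [dropletEnergy_succ J h (by omega)]
    have h2 : partialSum J k ≤ partialSum J (criticalSize J h - 1) :=
      partialSum_mono hJpos (by omega)
    have h3 : partialSum J m ≤ partialSum J (N - 1 - k) := partialSum_mono hJpos (by omega)
    linarith
  · rw [dropletEnergy_succ J h hkN]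
    have h2 : partialSum J (criticalSize J h) ≤ partialSum J k := partialSum_mono hJpos hk
    have h3 := partialSum_le_tsum hJpos hs (N - 1 - k)
    have h4 := tsum_sub_criticalSize_le hs hh
    linarith

/-! ### The energy landscape and paths of minimal height -/

/-- The number of sites with spin `+1`. -/
def level {N : ℕ} (σ : Config N) : ℕ := (plusSites σ).card

theorem level_leftConfig {N k : ℕ} (hk : k ≤ N) : level (leftConfig N k) = k := by
  rw [level, plusSites_leftConfig hk, Finset.card_range]

theorem level_minusOne (N : ℕ) : level (minusOne N) = 0 := by
  rw [level, plusSites_minusOne, Finset.card_empty]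

theorem level_plusOne (N : ℕ) : level (plusOne N) = N := by
  rw [plusOne_eq_leftConfig, level_leftConfig le_rfl]

theorem level_le_succ_of_conn {N : ℕ} {σ η : Config N} (hc : conn N σ η ≠ 0) :
    level η ≤ level σ + 1 := by
  have h1 : (Finset.univ.filter fun i => σ i ≠ η i).card = 1 := by
    by_contra h
    exact hc (if_neg h)
  simp only [level, plusSites, Finset.card_map]
  rw [← h1]
  refine (Finset.card_le_card ?_).trans (Finset.card_union_le _ _)
  intro i hi
  simp only [Finset.mem_union, Finset.mem_filter, Finset.mem_univ, true_and] at hi ⊢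
  by_cases h : σ i = 1
  · exact Or.inl h
  · exact Or.inr fun e => h (e.trans hi)

/-- Discrete intermediate value theorem: only upward jumps need to be bounded by one. -/
theorem exists_eq_of_le_succ {f : ℕ → ℕ} {n k : ℕ} (h0 : f 0 ≤ k) (hn : k ≤ f n)
    (hstep : ∀ t < n, f (t + 1) ≤ f t + 1) : ∃ t ≤ n, f t = k := by
  induction n with
  | zero => exact ⟨0, le_rfl, le_antisymm h0 hn⟩
  | succ n ih =>
    by_cases h : k ≤ f n
    · obtain ⟨t, ht, e⟩ := ih h fun t ht => hstep t (by omega)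
      exact ⟨t, by omega, e⟩
    · have := hstep n (by omega)
      exact ⟨n + 1, le_rfl, by omega⟩

/-- The features of the energy landscape in a large volume on which metastability rests. -/
structure Landscape (J : ℕ → ℝ) (h : ℝ) (N : ℕ) : Prop where
  one_le : 1 ≤ criticalSize J h
  lt : criticalSize J h < N
  climb : ∀ k < criticalSize J h, dropletEnergy J h N k ≤ dropletEnergy J h N (k + 1)
  descend : ∀ k, criticalSize J h ≤ k → k + 1 ≤ N →
    dropletEnergy J h N (k + 1) ≤ dropletEnergy J h N k
  strict : ∀ σ : Config N, level σ = criticalSize J h → σ ∉ criticalSet J h N →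
    dropletEnergy J h N (criticalSize J h) < energy J h N σ

theorem exists_landscape {J : ℕ → ℝ} {h : ℝ} (hJpos : ∀ n, 1 ≤ n → 0 < J n)
    (hJ : ∀ m n, 1 ≤ m → m ≤ n → J n ≤ J m) (hs : Summable fun n : ℕ => J (n + 1))
    (hh : 0 < h) (hlt : h < ∑' n, J (n + 1)) :
    ∃ N₀ : ℕ, ∀ N, N₀ ≤ N → Landscape J h N := by
  have hc := one_le_criticalSize hs hh hlt
  obtain ⟨N₁, h₁⟩ := exists_dropletEnergy_unimodal hJpos hs hh hlt
  obtain ⟨N₂, h₂⟩ := exists_cut_range_lt hJpos hJ hs hc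
  refine ⟨N₁ + N₂ + criticalSize J h + 1, fun N hN => ⟨hc, by omega, (h₁ N (by omega)).1,
    (h₁ N (by omega)).2, fun σ hσ hσc => ?_⟩⟩
  have hkN : criticalSize J h ≤ N := by omega
  have h3 := h₂ N (by omega) (plusSites σ) (plusSites_subset σ) hσ
    (fun e => hσc (Or.inl (plusSites_injective N (e.trans (plusSites_leftConfig hkN).symm))))
    (fun e => hσc (Or.inr (plusSites_injective N (e.trans (plusSites_rightConfig N _).symm))))
  rw [dropletEnergy, energy_eq_cut, energy_eq_cut J h σ, plusSites_leftConfig hkN,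
    Finset.card_range, show (plusSites σ).card = _ from hσ]
  linarith

theorem Landscape.dropletEnergy_le {J : ℕ → ℝ} {h : ℝ} {N : ℕ} (hL : Landscape J h N) {k : ℕ}
    (hk : k ≤ N) : dropletEnergy J h N k ≤ dropletEnergy J h N (criticalSize J h) := by
  rcases le_total k (criticalSize J h) with hle | hle
  · exact Nat.decreasingInduction (motive := fun k _ => dropletEnergy J h N k ≤ _)
      (fun k hk ih => (hL.climb k hk).trans ih) le_rfl hle
  · induction k, hle using Nat.le_induction with
    | base => rfl
    | succ k hle ih => exact (hL.descend k hle hk).trans (ih (by omega))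

theorem Landscape.Gam_eq {J : ℕ → ℝ} {h : ℝ} {N : ℕ} (hL : Landscape J h N) :
    Gam J h N = dropletEnergy J h N (criticalSize J h) - energy J h N (minusOne N) := by
  unfold Gam
  congr 1
  refine le_antisymm (Finset.sup'_le _ _ fun k hk => hL.dropletEnergy_le ?_)
    (Finset.le_sup' (dropletEnergy J h N) ?_)
  · have := Finset.mem_range.1 hk; omega
  · have := hL.lt
    exact Finset.mem_range.2 (by omega)

/-- The path crosses the critical level, where any configuration outside `criticalSet` would lift
its height above `Gam`. -/
theorem Landscape.exists_mem_criticalSet {J : ℕ → ℝ} {h : ℝ} {N : ℕ} (hL : Landscape J h N)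
    {n : ℕ} {γ : Fin (n + 1) → Config N} (hγ : IsPath N γ (minusOne N) (plusOne N))
    (hheight : height J h N γ - energy J h N (minusOne N) = Gam J h N) :
    ∃ i, γ i ∈ criticalSet J h N := by
  obtain ⟨h0, hn, hstep⟩ := hγ
  -- `Fin.ofNat` extends the path to all times modulo `n + 1`; only times up to `n` are used.
  obtain ⟨t, ht, hlev⟩ := exists_eq_of_le_succ (n := n) (k := criticalSize J h)
    (f := fun t => level (γ (Fin.ofNat (n + 1) t)))
    (by
      have : Fin.ofNat (n + 1) 0 = 0 := rfl
      simp [h0, level_minusOne])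
    (by
      have : Fin.ofNat (n + 1) n = Fin.last n := by ext; simp
      simp only [this, hn, level_plusOne]
      exact hL.lt.le)
    (fun t ht => by
      have h1 : Fin.ofNat (n + 1) t = (⟨t, ht⟩ : Fin n).castSucc := by
        ext; simp; omega
      have h2 : Fin.ofNat (n + 1) (t + 1) = (⟨t, ht⟩ : Fin n).succ := by
        ext; simp; omega
      simp only [h1, h2]
      exact level_le_succ_of_conn (hstep _).ne')
  refine ⟨Fin.ofNat (n + 1) t, ?_⟩
  by_contra hnot
  have h1 := hL.strict _ hlev hnot
  have h2 : energy J h N (γ (Fin.ofNat (n + 1) t)) ≤ height J h N γ :=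
    Finset.le_sup' (fun i => energy J h N (γ i)) (Finset.mem_univ _)
  rw [hL.Gam_eq] at hheight
  linarith

/-! ### Killed reversible chains on a finite set -/

section Killed

theorem sum_mul_le_of_le {α : Type*} [Fintype α] {P : α → α → ℝ} (hP : ∀ x y, 0 ≤ P x y) (hP1 : ∀ x, ∑ y, P x y = 1)
    {v : α → ℝ} {c : ℝ} (hv : ∀ x, v x ≤ c) (x : α) : ∑ y, P x y * v y ≤ c := by
  calc ∑ y, P x y * v y ≤ ∑ y, P x y * c :=
        Finset.sum_le_sum fun y _ => mul_le_mul_of_nonneg_left (hv y) (hP x y)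
    _ = c := by rw [← Finset.sum_mul, hP1, one_mul]

variable {α : Type*} [DecidableEq α]

/-- The transition matrix `P` killed on the set `S`. -/
def killed (P : α → α → ℝ) (S : Finset α) : Matrix α α ℝ :=
  Matrix.of fun x y => if x ∈ S ∨ y ∈ S then 0 else P x y

theorem killed_nonneg {P : α → α → ℝ} (hP : ∀ x y, 0 ≤ P x y) (S : Finset α) (x y : α) :
    0 ≤ killed P S x y := by
  simp only [killed, Matrix.of_apply]
  split_ifs
  exacts [le_rfl, hP x y]

theorem killed_le {P : α → α → ℝ} (hP : ∀ x y, 0 ≤ P x y) (S : Finset α) (x y : α) :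
    killed P S x y ≤ P x y := by
  simp only [killed, Matrix.of_apply]
  split_ifs
  exacts [hP x y, le_rfl]

theorem killed_of_notMem {P : α → α → ℝ} {S : Finset α} {x y : α} (hx : x ∉ S) (hy : y ∉ S) :
    killed P S x y = P x y := by
  simp [killed, hx, hy]

variable [Fintype α]

theorem killed_pow_nonneg {P : α → α → ℝ} (hP : ∀ x y, 0 ≤ P x y) (S : Finset α) (t : ℕ)
    (x y : α) : 0 ≤ (killed P S ^ t) x y := by
  induction t generalizing y with
  | zero => rw [pow_zero, Matrix.one_apply]; split_ifs <;> simp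
  | succ t ih =>
    rw [pow_succ, Matrix.mul_apply]
    exact Finset.sum_nonneg fun z _ => mul_nonneg (ih z) (killed_nonneg hP S z y)

theorem killed_pow_of_mem {P : α → α → ℝ} {S : Finset α} {x y : α} (hx : x ∉ S) (hy : y ∈ S)
    (t : ℕ) : (killed P S ^ t) x y = 0 := by
  cases t with
  | zero => rw [pow_zero, Matrix.one_apply_ne]; rintro rfl; exact hx hy
  | succ t =>
    rw [pow_succ, Matrix.mul_apply]
    exact Finset.sum_eq_zero fun z _ => by simp [killed, hy]

theorem killed_pow_succ_of_notMem {P : α → α → ℝ} {S : Finset α} {x y : α} (hx : x ∉ S)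
    (hy : y ∉ S) (t : ℕ) :
    (killed P S ^ (t + 1)) x y = ∑ z, (killed P S ^ t) x z * P z y := by
  rw [pow_succ, Matrix.mul_apply]
  refine Finset.sum_congr rfl fun z _ => ?_
  by_cases hz : z ∈ S
  · rw [killed_pow_of_mem hx hz, zero_mul, zero_mul]
  · rw [killed_of_notMem hz hy]

/-- Rows and columns in `S` are killed alike, so detailed balance survives and passes to powers. -/
theorem killed_pow_reversible {P : α → α → ℝ} {S : Finset α} {w : α → ℝ}
    (hw : ∀ x y, w x * P x y = w y * P y x) (t : ℕ) (x y : α) :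
    w x * (killed P S ^ t) x y = w y * (killed P S ^ t) y x := by
  have hK : ∀ x y, w x * killed P S x y = w y * killed P S y x := fun x y => by
    simp only [killed, Matrix.of_apply, or_comm (a := x ∈ S)]
    split_ifs
    · simp
    · exact hw x y
  induction t generalizing x y with
  | zero =>
    rw [pow_zero, Matrix.one_apply, Matrix.one_apply]
    rcases eq_or_ne x y with rfl | hxy
    · rfl
    · simp [hxy, hxy.symm]
  | succ t ih =>
    rw [pow_succ, Matrix.mul_apply, ← pow_succ, pow_succ', Matrix.mul_apply, Finset.mul_sum,
      Finset.mul_sum]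
    refine Finset.sum_congr rfl fun z _ => ?_
    rw [← mul_assoc, ih, mul_right_comm, hK]
    ring

/-- The expected number of visits to `x₀` before time `T` of the chain started at `x` and
killed on `S`. -/
def visits (P : α → α → ℝ) (S : Finset α) (x₀ : α) (T : ℕ) (x : α) : ℝ :=
  ∑ t ∈ Finset.range T, (killed P S ^ t) x x₀

theorem visits_succ (P : α → α → ℝ) (S : Finset α) (x₀ : α) (T : ℕ) (x : α) :
    visits P S x₀ (T + 1) x =
      ∑ y, killed P S x y * visits P S x₀ T y + if x = x₀ then 1 else 0 := by
  unfold visits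
  rw [Finset.sum_range_succ', pow_zero, Matrix.one_apply]
  congr 1
  simp only [pow_succ', Matrix.mul_apply, Finset.mul_sum]
  exact Finset.sum_comm

theorem visits_nonneg {P : α → α → ℝ} (hP : ∀ x y, 0 ≤ P x y) (S : Finset α) (x₀ : α) (T : ℕ)
    (x : α) : 0 ≤ visits P S x₀ T x :=
  Finset.sum_nonneg fun t _ => killed_pow_nonneg hP S t x x₀

/-- From `x` the chain must first reach `x₀` before any visit counts. Induction on the horizon
replaces the strong Markov property. -/
theorem visits_le {P : α → α → ℝ} (hP : ∀ x y, 0 ≤ P x y) (hP1 : ∀ x, ∑ y, P x y = 1)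
    (S : Finset α) (x₀ : α) (T : ℕ) (x : α) : visits P S x₀ T x ≤ visits P S x₀ T x₀ := by
  induction T generalizing x with
  | zero => simp [visits]
  | succ T ih =>
    rcases eq_or_ne x x₀ with rfl | hx
    · rfl
    · have h1 : visits P S x₀ T x₀ ≤ visits P S x₀ (T + 1) x₀ := by
        unfold visits
        rw [Finset.sum_range_succ]
        linarith [killed_pow_nonneg hP S T x₀ x₀]
      refine le_trans ?_ h1
      rw [visits_succ, if_neg hx, add_zero]
      refine le_trans (Finset.sum_le_sum fun y _ => ?_) (sum_mul_le_of_le hP hP1 ih x)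
      exact mul_le_mul_of_nonneg_right (killed_le hP S x y) (visits_nonneg hP S x₀ T y)

/-- The probability that the chain started at `x₀` is not killed up to time `t`. -/
def survival (P : α → α → ℝ) (S : Finset α) (x₀ : α) (t : ℕ) : ℝ :=
  ∑ y, (killed P S ^ t) x₀ y

/-- The mass killed at step `t + 1`, split according to the state at time `t`. -/
theorem survival_sub_succ (P : α → α → ℝ) (S : Finset α) (x₀ : α) (t : ℕ) :
    survival P S x₀ t - survival P S x₀ (t + 1) =
      ∑ x, (killed P S ^ t) x₀ x * (1 - ∑ y, killed P S x y) := by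
  unfold survival
  simp only [pow_succ, Matrix.mul_apply, mul_sub, mul_one, Finset.sum_sub_distrib, Finset.mul_sum]
  rw [Finset.sum_comm]

theorem sum_killed_add_le {P : α → α → ℝ} (hP : ∀ x y, 0 ≤ P x y) (hP1 : ∀ x, ∑ y, P x y = 1)
    {S : Finset α} {s : α} (hs : s ∈ S) (x : α) : ∑ y, killed P S x y + P x s ≤ 1 := by
  rw [← hP1 x, ← Finset.add_sum_erase _ (P x) (Finset.mem_univ s),
    ← Finset.add_sum_erase _ (killed P S x) (Finset.mem_univ s)]
  have h1 : killed P S x s = 0 := by simp [killed, hs]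
  have h2 := Finset.sum_le_sum (s := Finset.univ.erase s) fun y _ => killed_le hP S x y
  linarith

theorem survival_nonneg {P : α → α → ℝ} (hP : ∀ x y, 0 ≤ P x y) (S : Finset α) (x₀ : α) (t : ℕ) :
    0 ≤ survival P S x₀ t :=
  Finset.sum_nonneg fun y _ => killed_pow_nonneg hP S t x₀ y

theorem sum_killed_le {P : α → α → ℝ} (hP : ∀ x y, 0 ≤ P x y) (hP1 : ∀ x, ∑ y, P x y = 1)
    (S : Finset α) (x : α) : ∑ y, killed P S x y ≤ 1 := by
  rw [← hP1 x]
  exact Finset.sum_le_sum fun y _ => killed_le hP S x y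

theorem survival_antitone {P : α → α → ℝ} (hP : ∀ x y, 0 ≤ P x y) (hP1 : ∀ x, ∑ y, P x y = 1)
    (S : Finset α) (x₀ : α) : Antitone (survival P S x₀) :=
  antitone_nat_of_succ_le fun t => by
    rw [← sub_nonneg, survival_sub_succ]
    exact Finset.sum_nonneg fun x _ => mul_nonneg (killed_pow_nonneg hP S t x₀ x)
      (sub_nonneg.2 (sum_killed_le hP hP1 S x))

theorem survival_le_one {P : α → α → ℝ} (hP : ∀ x y, 0 ≤ P x y) (hP1 : ∀ x, ∑ y, P x y = 1)
    (S : Finset α) (x₀ : α) (t : ℕ) : survival P S x₀ t ≤ 1 := by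
  refine (survival_antitone hP hP1 S x₀ (Nat.zero_le t)).trans ?_
  simp [survival, Matrix.one_apply]

theorem mul_prod_le_killed_pow {P : α → α → ℝ} (hP : ∀ x y, 0 ≤ P x y) {S : Finset α}
    {x₀ : α} {l : ℕ → α} (hl0 : l 0 = x₀) {i : ℕ} (hl : ∀ j ≤ i, l j ∉ S) (t : ℕ) :
    (killed P S ^ t) x₀ x₀ * ∏ j ∈ Finset.range i, P (l j) (l (j + 1)) ≤
      (killed P S ^ (t + i)) x₀ (l i) := by
  induction i with
  | zero => simp [hl0]
  | succ i ih =>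
    rw [Finset.prod_range_succ, ← mul_assoc, ← add_assoc, pow_succ, Matrix.mul_apply]
    refine le_trans ?_ (Finset.single_le_sum
      (f := fun z => (killed P S ^ (t + i)) x₀ z * killed P S z (l (i + 1)))
      (fun z _ => mul_nonneg (killed_pow_nonneg hP S _ _ _) (killed_nonneg hP S _ _))
      (Finset.mem_univ (l i)))
    rw [killed_of_notMem (hl i (by omega)) (hl (i + 1) le_rfl)]
    exact mul_le_mul_of_nonneg_right (ih fun j hj => hl j (by omega)) (hP _ _)

/-- The expected number of returns to `x₀` before absorption is at most the inverse of the
probability of any path that leads from `x₀` to `S`. -/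
theorem visits_mul_prod_le_one {P : α → α → ℝ} (hP : ∀ x y, 0 ≤ P x y)
    (hP1 : ∀ x, ∑ y, P x y = 1) {S : Finset α} {x₀ : α} {l : ℕ → α} (hl0 : l 0 = x₀) {k : ℕ}
    (hl : ∀ j ≤ k, l j ∉ S) (hlk : l (k + 1) ∈ S) (T : ℕ) :
    visits P S x₀ T x₀ * ∏ j ∈ Finset.range (k + 1), P (l j) (l (j + 1)) ≤ 1 := by
  -- A chain that is at `x₀` at time `t` and then follows `l` is killed exactly at step `t + k + 1`.
  -- These events are disjoint for different `t`, so the bounds telescope.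
  have hstep : ∀ t, (killed P S ^ t) x₀ x₀ * ∏ j ∈ Finset.range (k + 1), P (l j) (l (j + 1)) ≤
      survival P S x₀ (t + k) - survival P S x₀ (t + 1 + k) := fun t => by
    rw [add_right_comm, survival_sub_succ, Finset.prod_range_succ, ← mul_assoc]
    refine le_trans ?_ (Finset.single_le_sum
      (f := fun x => (killed P S ^ (t + k)) x₀ x * (1 - ∑ y, killed P S x y))
      (fun x _ => mul_nonneg (killed_pow_nonneg hP S _ _ _)
        (sub_nonneg.2 (sum_killed_le hP hP1 S x))) (Finset.mem_univ (l k)))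
    exact mul_le_mul (mul_prod_le_killed_pow hP hl0 hl t)
      (by linarith [sum_killed_add_le hP hP1 hlk (l k)]) (hP _ _) (killed_pow_nonneg hP S _ _ _)
  unfold visits
  rw [Finset.sum_mul]
  refine (Finset.sum_le_sum fun t _ => hstep t).trans ?_
  rw [Finset.sum_range_sub' fun t => survival P S x₀ (t + k)]
  linarith [survival_le_one hP hP1 S x₀ (0 + k), survival_nonneg hP S x₀ (T + k)]

/-- A reversible chain started at `x₀` enters `S` at the point `q` with small probability
if `q` has small weight. -/
theorem mul_sum_entrance_le {P : α → α → ℝ} (hP : ∀ x y, 0 ≤ P x y) (hP1 : ∀ x, ∑ y, P x y = 1)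
    {w : α → ℝ} (hw0 : ∀ x, 0 ≤ w x) (hw : ∀ x y, w x * P x y = w y * P y x) (S : Finset α)
    (x₀ q : α) (T : ℕ) :
    w x₀ * ∑ t ∈ Finset.range T, ∑ x, (killed P S ^ t) x₀ x * P x q ≤
      w q * visits P S x₀ T x₀ := by
  -- Time reversal: a trajectory from `x₀` that ends with the step into `q` becomes one that steps
  -- out of `q` and reaches `x₀`.
  have h : w x₀ * ∑ t ∈ Finset.range T, ∑ x, (killed P S ^ t) x₀ x * P x q =
      w q * ∑ x, P q x * visits P S x₀ T x := by
    simp only [visits, Finset.mul_sum]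
    rw [Finset.sum_comm]
    refine Finset.sum_congr rfl fun x _ => Finset.sum_congr rfl fun t _ => ?_
    rw [← mul_assoc, killed_pow_reversible hw, mul_right_comm, hw x q]
    ring
  rw [h]
  exact mul_le_mul_of_nonneg_left
    (sum_mul_le_of_le hP hP1 (visits_le hP hP1 S x₀ T) q) (hw0 q)

/-- By reversibility the bound on visits to `x₀` bounds the expected visits from `x₀` to every
state. So the occupation probabilities are summable and tend to zero, and there are finitely many
states. -/
theorem survival_tendsto_zero {P : α → α → ℝ} (hP : ∀ x y, 0 ≤ P x y)
    (hP1 : ∀ x, ∑ y, P x y = 1) {w : α → ℝ} (hw0 : ∀ x, 0 < w x)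
    (hw : ∀ x y, w x * P x y = w y * P y x) {S : Finset α} {x₀ : α} {c : ℝ}
    (hc : ∀ T, visits P S x₀ T x₀ ≤ c) :
    Tendsto (survival P S x₀) atTop (𝓝 0) := by
  have h : ∀ x, Tendsto (fun t => (killed P S ^ t) x₀ x) atTop (𝓝 0) := fun x => by
    refine (summable_of_sum_range_le (c := w x / w x₀ * c)
      (fun t => killed_pow_nonneg hP S t x₀ x) fun T => ?_).tendsto_atTop_zero
    have h1 : ∀ t, (killed P S ^ t) x₀ x = w x / w x₀ * (killed P S ^ t) x x₀ := fun t => by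
      rw [div_mul_eq_mul_div, eq_div_iff (hw0 x₀).ne', mul_comm, killed_pow_reversible hw]
    simp only [h1, ← Finset.mul_sum]
    exact mul_le_mul_of_nonneg_left ((visits_le hP hP1 S x₀ T x).trans (hc T))
      (div_nonneg (hw0 x).le (hw0 x₀).le)
  have hsum := tendsto_finsetSum Finset.univ fun x _ => h x
  rwa [Finset.sum_const_zero] at hsum

end Killed

/-! ### Entrance estimates for the Metropolis chain -/

/-- The Gibbs weight. -/
def gibbs (J : ℕ → ℝ) (h : ℝ) (N : ℕ) (β : ℝ≥0) (σ : Config N) : ℝ :=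
  Real.exp (-(β : ℝ) * energy J h N σ)

theorem conn_comm (N : ℕ) (σ η : Config N) : conn N σ η = conn N η σ := by
  simp only [conn, ne_comm]

/-- For `σ ≠ η` both sides carry the exponent `-β` times the larger of the two energies. -/
theorem gibbs_reversible (J : ℕ → ℝ) (h : ℝ) (N : ℕ) (β : ℝ≥0) (σ η : Config N) :
    gibbs J h N β σ * transition J h N β σ η = gibbs J h N β η * transition J h N β η σ := by
  rcases eq_or_ne σ η with rfl | hne
  · rfl
  · simp only [transition, if_neg hne, if_neg hne.symm, weight, gibbs, conn_comm N η σ]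
    rw [mul_left_comm, mul_left_comm (Real.exp (-(β : ℝ) * energy J h N η)), ← Real.exp_add,
      ← Real.exp_add]
    congr 2
    rcases le_total (energy J h N σ) (energy J h N η) with hle | hle
    · rw [max_eq_left (by linarith), max_eq_right (by linarith)]; ring
    · rw [max_eq_right (by linarith), max_eq_left (by linarith)]; ring

theorem conn_leftConfig_succ {N k : ℕ} (hk : k < N) :
    conn N (leftConfig N k) (leftConfig N (k + 1)) = 1 / N := by
  have hiff : ∀ i : Fin N, leftConfig N k i ≠ leftConfig N (k + 1) i ↔ i = ⟨k, hk⟩ := fun i => by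
    have h1 : (1 : ℤˣ) ≠ -1 := by decide
    simp only [leftConfig, Fin.ext_iff]
    split_ifs <;> simp [h1, h1.symm] <;> omega
  refine if_pos (Finset.card_eq_one.2 ⟨⟨k, hk⟩, ?_⟩)
  ext i
  simp [hiff]

theorem Landscape.transition_leftConfig_succ {J : ℕ → ℝ} {h : ℝ} {N : ℕ} (hL : Landscape J h N)
    (β : ℝ≥0) {k : ℕ} (hk : k < criticalSize J h) :
    transition J h N β (leftConfig N k) (leftConfig N (k + 1)) =
      1 / N * Real.exp (-(β : ℝ) * (dropletEnergy J h N (k + 1) - dropletEnergy J h N k)) := by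
  have hlt := hL.lt
  have hne : leftConfig N k ≠ leftConfig N (k + 1) := fun e => by
    have := congrArg level e
    rw [level_leftConfig (by omega), level_leftConfig (by omega)] at this
    omega
  rw [transition, if_neg hne, weight, conn_leftConfig_succ (by omega), ← dropletEnergy,
    ← dropletEnergy, max_eq_left (sub_nonneg.2 (hL.climb k hk))]

/-- Every step up to the critical size is uphill or level, so the positive parts are plain
differences and telescope. -/
theorem Landscape.prod_transition {J : ℕ → ℝ} {h : ℝ} {N : ℕ} (hL : Landscape J h N)
    (β : ℝ≥0) {k : ℕ} (hk : k ≤ criticalSize J h) :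
    ∏ j ∈ Finset.range k, transition J h N β (leftConfig N j) (leftConfig N (j + 1)) =
      (1 / N) ^ k * Real.exp (-(β : ℝ) * (dropletEnergy J h N k - energy J h N (minusOne N))) := by
  induction k with
  | zero => simp [dropletEnergy_zero]
  | succ k ih =>
    rw [Finset.prod_range_succ, ih (by omega), hL.transition_leftConfig_succ β (by omega),
      mul_mul_mul_comm, ← Real.exp_add, pow_succ]
    congr 2
    ring

open Classical in
/-- The configurations whose number of plus spins is the critical size. -/
def criticalLevel (J : ℕ → ℝ) (h : ℝ) (N : ℕ) : Finset (Config N) :=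
  Finset.univ.filter fun σ => level σ = criticalSize J h

theorem mem_criticalLevel {J : ℕ → ℝ} {h : ℝ} {N : ℕ} {σ : Config N} :
    σ ∈ criticalLevel J h N ↔ level σ = criticalSize J h := by
  simp [criticalLevel]

theorem Landscape.minusOne_notMem {J : ℕ → ℝ} {h : ℝ} {N : ℕ} (hL : Landscape J h N) :
    minusOne N ∉ criticalLevel J h N := by
  have := hL.one_le
  rw [mem_criticalLevel, level_minusOne]
  omega

theorem Landscape.visits_minusOne_le {J : ℕ → ℝ} {h : ℝ} {N : ℕ} (hL : Landscape J h N)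
    (β : ℝ≥0) (T : ℕ) :
    visits (transition J h N β) (criticalLevel J h N) (minusOne N) T (minusOne N) ≤
      N ^ criticalSize J h * Real.exp (β * (dropletEnergy J h N (criticalSize J h)
        - energy J h N (minusOne N))) := by
  have hN : (0 : ℝ) < N := by
    have := hL.lt
    exact_mod_cast (by omega : 0 < N)
  have hlt := hL.lt
  obtain ⟨k, hk⟩ : ∃ k, criticalSize J h = k + 1 := ⟨_, (Nat.sub_add_cancel hL.one_le).symm⟩
  have h1 := visits_mul_prod_le_one (transition_nonneg J h N β) (sum_transition J h N β)
    (S := criticalLevel J h N) (l := leftConfig N) (leftConfig_zero N) (k := k)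
    (fun j hj => by
      rw [mem_criticalLevel, level_leftConfig (by omega)]; omega)
    (by rw [mem_criticalLevel, level_leftConfig (by omega), hk]) T
  rw [hL.prod_transition β hk.ge, ← hk] at h1
  rw [← le_div_iff₀ (by positivity)] at h1
  refine h1.trans (le_of_eq ?_)
  rw [neg_mul, Real.exp_neg, one_div_pow, one_div, mul_inv, one_div, inv_inv, inv_inv]

/-- The probability that the chain started at `-1` enters the critical level at `q`. -/
theorem Landscape.sum_entrance_le {J : ℕ → ℝ} {h : ℝ} {N : ℕ} (hL : Landscape J h N)
    (β : ℝ≥0) (q : Config N) (T : ℕ) :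
    ∑ t ∈ Finset.range T, ∑ x,
        (killed (transition J h N β) (criticalLevel J h N) ^ t) (minusOne N) x *
          transition J h N β x q ≤
      N ^ criticalSize J h *
        Real.exp (-(β * (energy J h N q - dropletEnergy J h N (criticalSize J h)))) := by
  have h1 := mul_sum_entrance_le (transition_nonneg J h N β) (sum_transition J h N β)
    (w := gibbs J h N β) (fun σ => (Real.exp_pos _).le) (gibbs_reversible J h N β) (criticalLevel J h N)
    (minusOne N) q T
  have h2 := mul_le_mul_of_nonneg_left (hL.visits_minusOne_le β T)
    (Real.exp_pos (-(β : ℝ) * energy J h N q)).le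
  refine le_of_mul_le_mul_left (h1.trans (h2.trans (le_of_eq ?_)))
    (Real.exp_pos (-(β : ℝ) * energy J h N (minusOne N)))
  simp only [gibbs]
  rw [mul_left_comm, mul_left_comm (Real.exp (-(β : ℝ) * energy J h N (minusOne N))),
    ← Real.exp_add, ← Real.exp_add]
  congr 2
  ring

/-! ### The law of the trajectories and the killed matrix -/

instance chainLaw_isProbabilityMeasure (J : ℕ → ℝ) (h : ℝ) (N : ℕ) (β : ℝ≥0) (σ : Config N) :
    IsProbabilityMeasure (chainLaw J h N β σ) := by
  unfold chainLaw
  infer_instance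

theorem stepKernel_singleton (J : ℕ → ℝ) (h : ℝ) (N : ℕ) (β : ℝ≥0) (σ η : Config N) :
    stepKernel J h N β σ {η} = ENNReal.ofReal (transition J h N β σ η) := by
  classical
  change stepLaw J h N β σ {η} = _
  simp only [stepLaw, Measure.coe_finsetSum, Finset.sum_apply, Measure.smul_apply, smul_eq_mul,
    Measure.dirac_apply, Set.indicator_apply, Set.mem_singleton_iff, Pi.one_apply, mul_ite, mul_one,
    mul_zero, Finset.sum_ite_eq', Finset.mem_univ, if_true]

/-- The Markov property. -/
theorem chainLaw_markov (J : ℕ → ℝ) (h : ℝ) (N : ℕ) (β : ℝ≥0) (σ₀ : Config N) (t : ℕ)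
    (A : Set ((_ : Finset.Iic t) → Config N)) (σ η : Config N) :
    chainLaw J h N β σ₀ {X | (Preorder.frestrictLe t X ∈ A ∧ X t = σ) ∧ X (t + 1) = η} =
      chainLaw J h N β σ₀ {X | Preorder.frestrictLe t X ∈ A ∧ X t = σ} *
        ENNReal.ofReal (transition J h N β σ η) := by
  set μ := chainLaw J h N β σ₀ with hμ
  have key : (μ.map (Preorder.frestrictLe t)) ⊗ₘ historyKernel J h N β t =
      μ.map (fun x => (Preorder.frestrictLe t x, x (t + 1))) :=
    Kernel.map_frestrictLe_trajMeasure_compProd_eq_map_trajMeasure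
  set B : Set ((_ : Finset.Iic t) → Config N) :=
    {x | x ∈ A ∧ x ⟨t, Finset.mem_Iic.2 le_rfl⟩ = σ} with hB
  -- Histories up to time `t` form a finite space, so every set of them is measurable.
  have hBm : MeasurableSet B := (Set.to_countable B).measurableSet
  have h1 : μ {X | Preorder.frestrictLe t X ∈ A ∧ X t = σ} =
      μ.map (Preorder.frestrictLe t) B := by
    rw [Measure.map_apply (by fun_prop) hBm]
    rfl
  have h2 : μ {X | (Preorder.frestrictLe t X ∈ A ∧ X t = σ) ∧ X (t + 1) = η} =
      μ.map (fun x => (Preorder.frestrictLe t x, x (t + 1))) (B ×ˢ {η}) := by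
    rw [Measure.map_apply (by fun_prop) (hBm.prod (measurableSet_singleton η))]
    rfl
  rw [h1, h2, ← key, Measure.compProd_apply_prod hBm (measurableSet_singleton η)]
  rw [setLIntegral_congr_fun hBm (g := fun _ => ENNReal.ofReal (transition J h N β σ η))]
  · rw [setLIntegral_const, mul_comm]
  · intro x hx
    change stepKernel J h N β (x ⟨t, _⟩) {η} = _
    rw [hx.2, stepKernel_singleton]

theorem chainLaw_start (J : ℕ → ℝ) (h : ℝ) (N : ℕ) (β : ℝ≥0) (σ₀ σ : Config N) :
    chainLaw J h N β σ₀ {X | X 0 = σ} = if σ₀ = σ then 1 else 0 := by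
  have key : (chainLaw J h N β σ₀).map (Preorder.frestrictLe 0) =
      (Measure.dirac σ₀).map (MeasurableEquiv.piUnique fun _ : Finset.Iic 0 => Config N).symm := by
    rw [chainLaw, Kernel.trajMeasure, Measure.map_comp _ _ (by fun_prop),
      Kernel.traj_map_frestrictLe, Kernel.partialTraj_self, Measure.id_comp]
  have hm : MeasurableSet {x : (_ : Finset.Iic 0) → Config N | x ⟨0, Finset.mem_Iic.2 le_rfl⟩ = σ} :=
    (Set.to_countable _).measurableSet
  have h1 : chainLaw J h N β σ₀ {X | X 0 = σ} = (chainLaw J h N β σ₀).map (Preorder.frestrictLe 0)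
      {x : (_ : Finset.Iic 0) → Config N | x ⟨0, Finset.mem_Iic.2 le_rfl⟩ = σ} := by
    rw [Measure.map_apply (by fun_prop) hm]
    rfl
  rw [h1, key, Measure.map_apply (MeasurableEquiv.measurable _) hm,
    Measure.dirac_apply' _ (MeasurableEquiv.measurable _ hm)]
  split_ifs with hσ
  · rw [Set.indicator_of_mem (by exact hσ), Pi.one_apply]
  · rw [Set.indicator_of_notMem (by exact hσ)]

/-- The event that the chain starts at `σ₀` and avoids `S` up to time `t`. -/
def avoids {N : ℕ} (S : Finset (Config N)) (σ₀ : Config N) (t : ℕ) : Set (ℕ → Config N) :=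
  {X | X 0 = σ₀ ∧ ∀ s ≤ t, X s ∉ S}

theorem chainLaw_avoids_step (J : ℕ → ℝ) (h : ℝ) (N : ℕ) (β : ℝ≥0) (S : Finset (Config N))
    (σ₀ : Config N) (t : ℕ) (σ η : Config N) :
    chainLaw J h N β σ₀ {X | (X ∈ avoids S σ₀ t ∧ X t = σ) ∧ X (t + 1) = η} =
      chainLaw J h N β σ₀ {X | X ∈ avoids S σ₀ t ∧ X t = σ} *
        ENNReal.ofReal (transition J h N β σ η) := by
  have hmarkov := chainLaw_markov J h N β σ₀ t
    {x | x ⟨0, Finset.mem_Iic.2 (Nat.zero_le t)⟩ = σ₀ ∧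
      ∀ s (hs : s ≤ t), x ⟨s, Finset.mem_Iic.2 hs⟩ ∉ S} σ η
  exact hmarkov

theorem measurable_eval_config {N : ℕ} (t : ℕ) (η : Config N) :
    MeasurableSet {X : ℕ → Config N | X t = η} :=
  (measurable_pi_apply t : Measurable fun X : ℕ → Config N => X t) (measurableSet_singleton η)

/-- Links the trajectory measure to the matrix estimates. The induction splits over the state at
time `t` and applies the Markov property to the history event of avoiding `S`. -/
theorem chainLaw_avoids (J : ℕ → ℝ) (h : ℝ) (N : ℕ) (β : ℝ≥0) {S : Finset (Config N)}
    {σ₀ : Config N} (h₀ : σ₀ ∉ S) (t : ℕ) (σ : Config N) :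
    chainLaw J h N β σ₀ {X | X ∈ avoids S σ₀ t ∧ X t = σ} =
      ENNReal.ofReal ((killed (transition J h N β) S ^ t) σ₀ σ) := by
  induction t generalizing σ with
  | zero =>
    rw [pow_zero, Matrix.one_apply]
    by_cases hσ : σ₀ = σ
    · subst hσ
      have : {X | X ∈ avoids S σ₀ 0 ∧ X 0 = σ₀} = {X : ℕ → Config N | X 0 = σ₀} := by
        ext X
        constructor
        · exact fun hX => hX.2
        · intro hX
          refine ⟨⟨hX, fun s hs => ?_⟩, hX⟩
          rw [Nat.le_zero.1 hs, show X 0 = σ₀ from hX]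
          exact h₀
      rw [this, chainLaw_start]
      simp
    · have : {X | X ∈ avoids S σ₀ 0 ∧ X 0 = σ} = ∅ := by
        ext X
        exact ⟨fun hX => hσ (hX.1.1.symm.trans hX.2), fun hX => hX.elim⟩
      rw [this]
      simp [hσ]
  | succ t ih =>
    by_cases hσ : σ ∈ S
    · have : {X | X ∈ avoids S σ₀ (t + 1) ∧ X (t + 1) = σ} = ∅ := by
        ext X
        exact ⟨fun hX => hX.1.2 (t + 1) le_rfl (hX.2 ▸ hσ), fun hX => hX.elim⟩
      rw [this, killed_pow_of_mem h₀ hσ]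
      simp
    · have hU : {X | X ∈ avoids S σ₀ (t + 1) ∧ X (t + 1) = σ} =
          ⋃ ζ ∈ (Finset.univ : Finset (Config N)),
            {X | (X ∈ avoids S σ₀ t ∧ X t = ζ) ∧ X (t + 1) = σ} := by
        ext X
        simp only [Finset.mem_univ, Set.iUnion_true, Set.mem_iUnion]
        constructor
        · rintro ⟨⟨h1, h2⟩, h3⟩
          exact ⟨X t, ⟨⟨h1, fun s hs => h2 s (by omega)⟩, rfl⟩, h3⟩
        · rintro ⟨ζ, ⟨⟨h1, h2⟩, -⟩, h3⟩
          refine ⟨⟨h1, fun s hs => ?_⟩, h3⟩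
          rcases Nat.le_succ_iff.1 hs with hs | rfl
          · exact h2 s hs
          · rw [show X (t + 1) = σ from h3]; exact hσ
      have hmeas : ∀ ζ, MeasurableSet {X | (X ∈ avoids S σ₀ t ∧ X t = ζ) ∧ X (t + 1) = σ} :=
        fun ζ => by
          have hB : MeasurableSet {x : (_ : Finset.Iic t) → Config N |
              (x ⟨0, Finset.mem_Iic.2 (Nat.zero_le t)⟩ = σ₀ ∧
                ∀ s (hs : s ≤ t), x ⟨s, Finset.mem_Iic.2 hs⟩ ∉ S) ∧
              x ⟨t, Finset.mem_Iic.2 le_rfl⟩ = ζ} := (Set.to_countable _).measurableSet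
          exact (Preorder.measurable_frestrictLe t hB).inter (measurable_eval_config (t + 1) σ)
      rw [hU, measure_biUnion_finset (fun ζ _ ξ _ hne => Set.disjoint_left.2 fun X hX hX' =>
        hne (hX.1.2.symm.trans hX'.1.2)) fun ζ _ => hmeas ζ]
      simp only [chainLaw_avoids_step, ih]
      rw [killed_pow_succ_of_notMem h₀ hσ, ENNReal.ofReal_sum_of_nonneg]
      · refine Finset.sum_congr rfl fun ζ _ => ?_
        rw [ENNReal.ofReal_mul (killed_pow_nonneg (transition_nonneg J h N β) S t σ₀ ζ)]
      · exact fun ζ _ => mul_nonneg (killed_pow_nonneg (transition_nonneg J h N β) S t σ₀ ζ)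
          (transition_nonneg J h N β ζ σ)

theorem chainLaw_avoids_le (J : ℕ → ℝ) (h : ℝ) (N : ℕ) (β : ℝ≥0) {S : Finset (Config N)}
    {σ₀ : Config N} (h₀ : σ₀ ∉ S) (t : ℕ) :
    chainLaw J h N β σ₀ (avoids S σ₀ t) ≤
      ENNReal.ofReal (survival (transition J h N β) S σ₀ t) := by
  have hsub : avoids S σ₀ t ⊆ ⋃ σ ∈ (Finset.univ : Finset (Config N)),
      {X | X ∈ avoids S σ₀ t ∧ X t = σ} := fun X hX => by
    simp only [Finset.mem_univ, Set.iUnion_true, Set.mem_iUnion]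
    exact ⟨X t, hX, rfl⟩
  refine (measure_mono hsub).trans ((measure_biUnion_finset_le _ _).trans (le_of_eq ?_))
  rw [survival, ENNReal.ofReal_sum_of_nonneg fun σ _ =>
    killed_pow_nonneg (transition_nonneg J h N β) S t σ₀ σ]
  exact Finset.sum_congr rfl fun σ _ => chainLaw_avoids J h N β h₀ t σ

/-- The event that the chain, started at `σ₀`, enters `S` at `q` before or at time `T`. -/
def entersAt {N : ℕ} (S : Finset (Config N)) (σ₀ q : Config N) (T : ℕ) : Set (ℕ → Config N) :=
  {X | ∃ t < T, X ∈ avoids S σ₀ t ∧ X (t + 1) = q}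

theorem chainLaw_entersAt_le (J : ℕ → ℝ) (h : ℝ) (N : ℕ) (β : ℝ≥0) {S : Finset (Config N)}
    {σ₀ : Config N} (h₀ : σ₀ ∉ S) (q : Config N) (T : ℕ) :
    chainLaw J h N β σ₀ (entersAt S σ₀ q T) ≤
      ENNReal.ofReal (∑ t ∈ Finset.range T, ∑ x,
        (killed (transition J h N β) S ^ t) σ₀ x * transition J h N β x q) := by
  have hnn : ∀ t x, 0 ≤ (killed (transition J h N β) S ^ t) σ₀ x * transition J h N β x q :=
    fun t x => mul_nonneg (killed_pow_nonneg (transition_nonneg J h N β) S t σ₀ x)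
      (transition_nonneg J h N β x q)
  have hsub : entersAt S σ₀ q T ⊆ ⋃ t ∈ Finset.range T, ⋃ σ ∈ (Finset.univ : Finset (Config N)),
      {X | (X ∈ avoids S σ₀ t ∧ X t = σ) ∧ X (t + 1) = q} := by
    rintro X ⟨t, ht, hX, hq⟩
    simp only [Finset.mem_univ, Set.iUnion_true, Set.mem_iUnion, Finset.mem_range]
    exact ⟨t, ht, X t, ⟨hX, rfl⟩, hq⟩
  refine (measure_mono hsub).trans ((measure_biUnion_finset_le _ _).trans ?_)
  rw [ENNReal.ofReal_sum_of_nonneg fun t _ => Finset.sum_nonneg fun x _ => hnn t x]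
  refine Finset.sum_le_sum fun t _ => (measure_biUnion_finset_le _ _).trans (le_of_eq ?_)
  rw [ENNReal.ofReal_sum_of_nonneg fun x _ => hnn t x]
  refine Finset.sum_congr rfl fun x _ => ?_
  rw [chainLaw_avoids_step, chainLaw_avoids J h N β h₀,
    ENNReal.ofReal_mul (killed_pow_nonneg (transition_nonneg J h N β) S t σ₀ x)]

theorem level_le_succ_of_transition {J : ℕ → ℝ} {h : ℝ} {N : ℕ} {β : ℝ≥0} {σ η : Config N}
    (hp : transition J h N β σ η ≠ 0) : level η ≤ level σ + 1 := by
  rcases eq_or_ne σ η with rfl | hne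
  · omega
  · rw [transition, if_neg hne, weight] at hp
    exact level_le_succ_of_conn (left_ne_zero_of_mul hp)

/-- A transition of probability zero is almost surely never taken, and there are countably many
times and finitely many pairs of states. -/
theorem ae_level_le_succ (J : ℕ → ℝ) (h : ℝ) (N : ℕ) (β : ℝ≥0) (σ₀ : Config N) :
    ∀ᵐ X ∂chainLaw J h N β σ₀, ∀ t, level (X (t + 1)) ≤ level (X t) + 1 := by
  rw [ae_all_iff]
  intro t
  have hall : ∀ p : Config N × Config N, ∀ᵐ X ∂chainLaw J h N β σ₀,
      X t = p.1 → X (t + 1) = p.2 → level p.2 ≤ level p.1 + 1 := by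
    rintro ⟨σ, η⟩
    by_cases hp : transition J h N β σ η = 0
    · have hz := chainLaw_markov J h N β σ₀ t Set.univ σ η
      rw [hp, ENNReal.ofReal_zero, mul_zero] at hz
      refine measure_mono_null (fun X hX => ?_) hz
      simp only [Set.mem_compl_iff, Set.mem_ofPred_eq, Classical.not_imp] at hX
      exact ⟨⟨Set.mem_univ _, hX.1⟩, hX.2.1⟩
    · exact Eventually.of_forall fun X _ _ => level_le_succ_of_transition hp
  filter_upwards [ae_all_iff.2 hall] with X hX
  exact hX (X t, X (t + 1)) rfl rfl

/-! ### Hitting times and the limit -/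

theorem hittingTime_le {N : ℕ} {A : Set (Config N)} {X : ℕ → Config N} {t : ℕ} (ht : 0 < t)
    (hX : X t ∈ A) : hittingTime A X ≤ t :=
  iInf₂_le (f := fun (t : ℕ) (_ : 0 < t ∧ X t ∈ A) => (t : ℕ∞)) t ⟨ht, hX⟩

theorem lt_hittingTime {N : ℕ} {A : Set (Config N)} {X : ℕ → Config N} {t : ℕ}
    (hX : ∀ s ≤ t, X s ∉ A) : (t : ℕ∞) < hittingTime A X := by
  refine lt_of_lt_of_le (b := ((t + 1 : ℕ) : ℕ∞)) (by exact_mod_cast Nat.lt_succ_self t) ?_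
  refine le_iInf₂ fun s hs => ?_
  have : t < s := by
    by_contra! hc
    exact hX s hc hs.2
  exact_mod_cast this

/-- The first visit to the critical level occurs by time `T` and is in `criticalSet`. It is at a
positive time because `minusOne` is not on that level. Reaching `plusOne`, which lies above it,
requires an earlier visit to the level. -/
theorem Landscape.hittingTime_lt {J : ℕ → ℝ} {h : ℝ} {N : ℕ} (hL : Landscape J h N)
    {X : ℕ → Config N} (h0 : X 0 = minusOne N)
    (hstep : ∀ t, level (X (t + 1)) ≤ level (X t) + 1) {T : ℕ}
    (hT : X ∉ avoids (criticalLevel J h N) (minusOne N) T)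
    (hQ : ∀ q ∈ criticalLevel J h N, q ∉ criticalSet J h N →
      X ∉ entersAt (criticalLevel J h N) (minusOne N) q T) :
    hittingTime (criticalSet J h N) X < hittingTime {plusOne N} X := by
  classical
  have hex : ∃ s, s ≤ T ∧ X s ∈ criticalLevel J h N := by
    by_contra! hc
    exact hT ⟨h0, hc⟩
  have hex' : ∃ s, X s ∈ criticalLevel J h N := hex.imp fun _ hs => hs.2
  have hmin : ∀ s < Nat.find hex', X s ∉ criticalLevel J h N := fun s hs => Nat.find_min hex' hs
  have hle : Nat.find hex' ≤ T := by
    obtain ⟨s, hs, hs'⟩ := hex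
    exact (Nat.find_min' hex' hs').trans hs
  have hmem := Nat.find_spec hex'
  generalize Nat.find hex' = t at hmin hle hmem
  have ht : t ≠ 0 := by
    rintro rfl
    exact hL.minusOne_notMem (h0 ▸ hmem)
  obtain ⟨s, rfl⟩ := Nat.exists_eq_succ_of_ne_zero ht
  have hcrit : X (s + 1) ∈ criticalSet J h N := by
    by_contra hnot
    exact hQ _ hmem hnot ⟨s, by omega, ⟨h0, fun u hu => hmin u (by omega)⟩, rfl⟩
  refine (hittingTime_le (Nat.succ_pos s) hcrit).trans_lt (lt_hittingTime fun u hu hu' => ?_)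
  have hlev : level (X u) = N := by rw [show X u = plusOne N from hu', level_plusOne]
  have hlt := hL.lt
  obtain ⟨v, hv, hv'⟩ := exists_eq_of_le_succ (f := fun t => level (X t)) (n := u)
    (k := criticalSize J h) (by simp [h0, level_minusOne]) (by simp only [hlev]; omega)
    fun t _ => hstep t
  have hvu : v ≠ u := by
    rintro rfl
    omega
  exact hmin v (by omega) (mem_criticalLevel.2 hv')

open Classical in
/-- The configurations at the critical level other than the critical droplets. -/
def nonCritical (J : ℕ → ℝ) (h : ℝ) (N : ℕ) : Finset (Config N) :=
  (criticalLevel J h N).filter fun q => q ∉ criticalSet J h N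

/-- The chain started at `-1` misses the critical droplets with exponentially small probability. -/
theorem Landscape.chainLaw_compl_le {J : ℕ → ℝ} {h : ℝ} {N : ℕ} (hL : Landscape J h N)
    (β : ℝ≥0) :
    chainLaw J h N β (minusOne N)
        {X | hittingTime (criticalSet J h N) X < hittingTime {plusOne N} X}ᶜ ≤
      ENNReal.ofReal (∑ q ∈ nonCritical J h N, N ^ criticalSize J h *
        Real.exp (-(β * (energy J h N q - dropletEnergy J h N (criticalSize J h))))) := by
  set S := criticalLevel J h N with hS
  set μ := chainLaw J h N β (minusOne N) with hμ
  have hstart : ∀ᵐ X ∂μ, X 0 = minusOne N := by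
    have hm : MeasurableSet {X : ℕ → Config N | X 0 = minusOne N} := measurable_eval_config 0 _
    exact (prob_compl_eq_zero_iff hm).2 (by rw [hμ, chainLaw_start, if_pos rfl])
  -- Failure means either that the critical level is not reached by time `T` or that it is entered
  -- outside `criticalSet`. The second bound does not depend on `T`, and the first vanishes as `T →
  -- ∞`.
  have hbound : ∀ T, μ {X | hittingTime (criticalSet J h N) X < hittingTime {plusOne N} X}ᶜ ≤
      ENNReal.ofReal (survival (transition J h N β) S (minusOne N) T) +
      ENNReal.ofReal (∑ q ∈ nonCritical J h N, N ^ criticalSize J h *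
        Real.exp (-(β * (energy J h N q - dropletEnergy J h N (criticalSize J h))))) := by
    intro T
    have hsub : {X | hittingTime (criticalSet J h N) X < hittingTime {plusOne N} X}ᶜ ≤ᵐ[μ]
        (avoids S (minusOne N) T ∪ ⋃ q ∈ nonCritical J h N, entersAt S (minusOne N) q T :
          Set (ℕ → Config N)) := by
      filter_upwards [hstart, ae_level_le_succ J h N β (minusOne N)] with X h0 hstep hX
      by_contra hc
      refine hX (hL.hittingTime_lt h0 hstep (T := T) (fun hA => hc (Or.inl hA))
        fun q hq hq' hE => hc (Or.inr ?_))
      exact Set.mem_biUnion (show q ∈ (nonCritical J h N : Set _) by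
        simp [nonCritical, hq, hq']) hE
    refine (measure_mono_ae hsub).trans ((measure_union_le _ _).trans (add_le_add
      (chainLaw_avoids_le J h N β hL.minusOne_notMem T) ?_))
    refine (measure_biUnion_finset_le _ _).trans ?_
    rw [ENNReal.ofReal_sum_of_nonneg fun q _ => by positivity]
    exact Finset.sum_le_sum fun q _ =>
      (chainLaw_entersAt_le J h N β hL.minusOne_notMem q T).trans
        (ENNReal.ofReal_le_ofReal (hL.sum_entrance_le β q T))
  have hlim : Tendsto (survival (transition J h N β) S (minusOne N)) atTop (𝓝 0) :=
    survival_tendsto_zero (transition_nonneg J h N β) (sum_transition J h N β)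
      (w := gibbs J h N β) (fun σ => Real.exp_pos _) (gibbs_reversible J h N β)
      (hL.visits_minusOne_le β)
  have hlim' := ((ENNReal.tendsto_ofReal hlim).add_const (ENNReal.ofReal
    (∑ q ∈ nonCritical J h N, N ^ criticalSize J h *
        Real.exp (-(β * (energy J h N q - dropletEnergy J h N (criticalSize J h)))))))
  rw [ENNReal.ofReal_zero, zero_add] at hlim'
  exact ge_of_tendsto' hlim' hbound

theorem Landscape.tendsto_chainLaw {J : ℕ → ℝ} {h : ℝ} {N : ℕ} (hL : Landscape J h N) :
    Tendsto (fun β : ℝ≥0 => chainLaw J h N β (minusOne N)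
      {X | hittingTime (criticalSet J h N) X < hittingTime {plusOne N} X}) atTop (𝓝 1) := by
  have hexp : ∀ q ∈ nonCritical J h N, Tendsto (fun β : ℝ≥0 => (N : ℝ) ^ criticalSize J h *
      Real.exp (-(β * (energy J h N q - dropletEnergy J h N (criticalSize J h))))) atTop (𝓝 0) := by
    intro q hq
    have hlt : 0 < energy J h N q - dropletEnergy J h N (criticalSize J h) := by
      classical
      simp only [nonCritical, Finset.mem_filter, mem_criticalLevel] at hq
      exact sub_pos.2 (hL.strict q hq.1 hq.2)
    have h1 : Tendsto (fun β : ℝ≥0 => (β : ℝ)) atTop atTop := NNReal.tendsto_coe_atTop.2 tendsto_id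
    simpa using (Real.tendsto_exp_neg_atTop_nhds_zero.comp
      (h1.atTop_mul_const hlt)).const_mul ((N : ℝ) ^ criticalSize J h)
  have hsum := ENNReal.tendsto_ofReal (tendsto_finsetSum (nonCritical J h N) hexp)
  rw [Finset.sum_const_zero, ENNReal.ofReal_zero] at hsum
  have hone := ENNReal.Tendsto.sub (tendsto_const_nhds (x := (1 : ℝ≥0∞)) (f := atTop)) hsum
    (Or.inl ENNReal.one_ne_top)
  rw [tsub_zero] at hone
  refine tendsto_of_tendsto_of_tendsto_of_le_of_le hone tendsto_const_nhds (fun β => ?_)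
    fun β => prob_le_one
  -- Subadditivity over the event and its complement suffices, so measurability of the event plays
  -- no role.
  rw [tsub_le_iff_right, ← measure_univ (μ := chainLaw J h N β (minusOne N)),
    ← Set.union_compl_self {X | hittingTime (criticalSet J h N) X < hittingTime {plusOne N} X}]
  exact (measure_union_le _ _).trans (add_le_add le_rfl (hL.chainLaw_compl_le β))

end LongRangeIsing

end

theorem lemma3p6 (J : ℕ → ℝ) (h : ℝ)
    (hJpos : ∀ n : ℕ, 1 ≤ n → 0 < J n)
    (hJdecr : ∀ m n : ℕ, 1 ≤ m → m ≤ n → J n ≤ J m)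
    (hJsum : Summable fun n : ℕ => J (n + 1))
    (hh : 0 < h) (hhlt : h < ∑' n : ℕ, J (n + 1)) :
    ∃ N₀ : ℕ, ∀ N : ℕ, N₀ ≤ N →
      (∀ (n : ℕ) (γ : Fin (n + 1) → Config N),
        IsPath N γ (minusOne N) (plusOne N) →
        height J h N γ - energy J h N (minusOne N) = Gam J h N →
        ∃ i, γ i ∈ criticalSet J h N) ∧
      Tendsto (fun β : ℝ≥0 => chainLaw J h N β (minusOne N)
          {X | hittingTime (criticalSet J h N) X < hittingTime {plusOne N} X})
        atTop (𝓝 1) := by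
  obtain ⟨N₀, hN₀⟩ := exists_landscape hJpos hJdecr hJsum hh hhlt
  exact ⟨N₀, fun N hN => ⟨fun _ _ hγ hheight => (hN₀ N hN).exists_mem_criticalSet hγ hheight,
    (hN₀ N hN).tendsto_chainLaw⟩⟩
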